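/- \textbf{Parameters.} Let $m,p\in\mathbb N_0$, $A=((a_i,\alpha_i))_{1\le i\le p}$ and $B=((b_j,\beta_j))_{1\le j\le m}$ with $a_i,b_j\in\mathbb R$, $\alpha_i,\beta_j>0$, $a_i+\alpha_i>0$, $b_j+\beta_j>0$. Put $a^*=\sum_j\beta_j-\sum_i\alpha_i$ and $\mu=\sum_j b_j-\sum_i a_i+\frac{p-m}{2}$, and assume that either $a^*>0$, or $a^*=0$ and $\mu<-1$. For $\tau>0$ let $$H^{m,0}_{p,m}(\tau)=\frac1{2\pi\mathrm i}\int_{c-\mathrm i\infty}^{c+\mathrm i\infty}\frac{\prod_{j=1}^m\Gamma(b_j+s\beta_j)}{\prod_{i=1}^p\Gamma(a_i+s\alpha_i)}\,\tau^{-s}\,\mathrm ds,\qquad c>\max_j(-b_j/\beta_j),$$ be the Fox-$H$ function, and assume that it is non-negative on $(0,\infty)$. Put $K=\prod_{j}\Gamma(b_j+\beta_j)/\prod_{i}\Gamma(a_i+\alpha_i)$. \textbf{The generalized Fox-$H$ process.} For $x\le 0$ let $${}_m\Psi_p(x)=\sum_{k\ge0}\frac{\prod_{j=1}^m\Gamma(b_j+\beta_j+\beta_jk)}{\prod_{i=1}^p\Gamma(a_i+\alpha_i+\alpha_ik)}\frac{x^k}{k!}$$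 where this series converges absolutely, and otherwise let ${}_m\Psi_p(x)$ be the value at $z=-x$ of its Fox-$H$ representation $$H^{1,m}_{m,p+1}\left[z\,\middle|\,{(1-b_j-\beta_j,\beta_j)_{1,m}\atop(0,1),(1-a_i-\alpha_i,\alpha_i)_{1,p}}\right]=\frac1{2\pi\mathrm i}\int_{c-\mathrm i\infty}^{c+\mathrm i\infty}\frac{\Gamma(s)\prod_{j=1}^m\Gamma(b_j+\beta_j-s\beta_j)}{\prod_{i=1}^p\Gamma(a_i+\alpha_i-s\alpha_i)}z^{-s}\,\mathrm ds,\qquad 0<c<\min_j\frac{b_j+\beta_j}{\beta_j}.$$ Let $\mu_\Psi$ be the generalized Fox-$H$ measure, i.e. the probability measure on the real dual $\mathcal S'(\mathbb R)$ of the Schwartz space, with the cylinder $\sigma$-algebra, such that $\int \mathrm e^{\mathrm i\langle\omega,\varphi\rangle}\,\mathrm d\mu_\Psi(\omega)=\frac1K\,{}_m\Psi_p\!\left(-\tfrac12\int_{\mathbb R}\varphi^2\right)$ for all $\varphi\in\mathcal S(\mathbb R)$. For $f\in L^2(\mathbb R)$ let $\langle\cdot,f\rangle$ be the $L^2(\mu_\Psi)$-limit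 of $\langle\cdot,\varphi_n\rangle$, where $\varphi_n\in\mathcal S(\mathbb R)$ and $\varphi_n\to f$ in $L^2(\mathbb R)$. For $\mathbb H\in(0,1)$ the generalized Fox-$H$ process is $X^{\mathbb H,A,B}_t=\langle\cdot,M_-^{\mathbb H}\mathbf 1_{[0,t)}\rangle$, $t\ge0$. Here $M_-^{\mathbb H}$ is $K_{\mathbb H}D_-^{1/2-\mathbb H}$ for $\mathbb H<\frac12$, the identity for $\mathbb H=\frac12$, and $K_{\mathbb H}I_-^{\mathbb H-1/2}$ for $\mathbb H>\frac12$, with the right-sided Riemann-Liouville derivative and integral on $\mathbb R$, $$(D_-^{\sigma}f)(x)=-\frac1{\Gamma(1-\sigma)}\frac{\mathrm d}{\mathrm dx}\int_x^\infty f(t)(t-x)^{-\sigma}\,\mathrm dt,\qquad (I_-^{\sigma}f)(x)=\frac1{\Gamma(\sigma)}\int_x^\infty f(t)(t-x)^{\sigma-1}\,\mathrm dt,$$ and $K_{\mathbb H}=\Gamma(\mathbb H+\tfrac12)\left(\int_0^\infty\big((1+s)^{\mathbb H-1/2}-s^{\mathbb H-1/2}\big)^2\mathrm ds+\tfrac1{2\mathbb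 H}\right)^{-1/2}$. \textbf{Proposition.} On a probability space $(\Omega,\mathcal A,\mathbb P)$ let $Y_{A,B}$ be a random variable with density $H^{m,0}_{p,m}/K$ on $(0,\infty)$, and let $(B^{\mathbb H}_t)_{t\ge0}$ be a fractional Brownian motion with Hurst parameter $\mathbb H\in(0,1)$, that is, a centered Gaussian process with covariance $\frac12(s^{2\mathbb H}+t^{2\mathbb H}-|t-s|^{2\mathbb H})$ and almost surely continuous paths. If $Y_{A,B}$ and $B^{\mathbb H}$ are independent, then, in the sense of equality of all finite-dimensional distributions, $$\{X^{\mathbb H,A,B}_t,\ t\ge0\}\;=\;\{\sqrt{Y_{A,B}}\,B^{\mathbb H}_t,\ t\ge0\}\;=\;\{B^{\mathbb H}_{t\,(Y_{A,B})^{1/(2\mathbb H)}},\ t\ge0\}.$$ -/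

import Mathlib

open MeasureTheory ProbabilityTheory Filter Topology Set
open scoped NNReal ENNReal SchwartzMap

noncomputable section

/-! ### Fox H-functions and generalized Wright functions

A list of parameters `(c_k, γ_k)`, `k = 1, …, r`, is a function `Fin r → ℝ × ℝ`. -/

/-- The Mellin-Barnes kernel of `H^{m,n}_{p,q}` with upper parameters `A = (a_i, α_i)_{1,p}` and
lower parameters `B = (b_j, β_j)_{1,q}`. (`1 / Γ` vanishes at the poles of `Γ`, as it should.) -/
def foxHKernel (m n : ℕ) {p q : ℕ} (A : Fin p → ℝ × ℝ) (B : Fin q → ℝ × ℝ) (s : ℂ) : ℂ :=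
  ((∏ j : Fin q with j.val < m, Complex.Gamma ((B j).1 + s * (B j).2)) *
    ∏ i : Fin p with i.val < n, Complex.Gamma (1 - (A i).1 - s * (A i).2)) /
  ((∏ i : Fin p with n ≤ i.val, Complex.Gamma ((A i).1 + s * (A i).2)) *
    ∏ j : Fin q with m ≤ j.val, Complex.Gamma (1 - (B j).1 - s * (B j).2))

/-- The vertical line `Re s = c` has the poles `-(b_j + l) / β_j` (`j ≤ m`, `l = 0, 1, …`) on its
left and the poles `(1 - a_i + k) / α_i` (`i ≤ n`, `k = 0, 1, …`) on its right. -/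
def FoxHSeparates (m n : ℕ) {p q : ℕ} (A : Fin p → ℝ × ℝ) (B : Fin q → ℝ × ℝ) (c : ℝ) : Prop :=
  (∀ j : Fin q, j.val < m → 0 < (B j).1 + c * (B j).2) ∧
  (∀ i : Fin p, i.val < n → 0 < 1 - (A i).1 - c * (A i).2)

open Classical in
/-- The Fox H-function `H^{m,n}_{p,q}[x | A; B]` for `x > 0`, with the contour
`c - i∞ → c + i∞` on a vertical line that separates the two families of poles:
`mellinInv c F x` is `(2πi)⁻¹ ∫ F(s) x^(-s) ds` along that line. By Cauchy's theorem the value does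
not depend on `c`. -/
def foxH (m n : ℕ) {p q : ℕ} (A : Fin p → ℝ × ℝ) (B : Fin q → ℝ × ℝ) (x : ℝ) : ℂ :=
  if h : ∃ c : ℝ, FoxHSeparates m n A B c then
    mellinInv h.choose (foxHKernel m n A B) x
  else 0

/-- The general term of the series of the generalized Wright function
`_mΨ_p[(A_i, α_i)_{1,m}; (B_j, β_j)_{1,p} | x]`. -/
def wrightTerm {m p : ℕ} (A : Fin m → ℝ × ℝ) (B : Fin p → ℝ × ℝ) (x : ℝ) (k : ℕ) : ℝ :=
  (∏ i, Real.Gamma ((A i).1 + (A i).2 * k)) / (∏ j, Real.Gamma ((B j).1 + (B j).2 * k)) *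
    (x ^ k / k.factorial)

open Classical in
/-- The generalized Wright function at a real argument `x ≤ 0`: the sum of its series and, where
the series does not converge, the value of its Fox-H representation
`_mΨ_p[A; B | -z] = H^{1,m}_{m,p+1}[z | (1 - A_i, α_i)_{1,m}; (0,1), (1 - B_j, β_j)_{1,p}]`. -/
def genWright {m p : ℕ} (A : Fin m → ℝ × ℝ) (B : Fin p → ℝ × ℝ) (x : ℝ) : ℝ :=
  if Summable (wrightTerm A B x) then ∑' k, wrightTerm A B x k
  else (foxH 1 m (fun i => (1 - (A i).1, (A i).2))
    (Fin.cons ((0 : ℝ), (1 : ℝ)) (fun j => (1 - (B j).1, (B j).2)) : Fin (p + 1) → ℝ × ℝ) (-x)).re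

/-- The density candidate `H^{m,0}_{p,m}[τ | (a_i, α_i)_{1,p}; (b_j, β_j)_{1,m}]`; it is real for
real parameters and `τ > 0`. -/
def foxHm0 {p m : ℕ} (A : Fin p → ℝ × ℝ) (B : Fin m → ℝ × ℝ) (τ : ℝ) : ℝ :=
  (foxH m 0 A B τ).re

/-- `K = ∏ Γ(b_j + β_j) / ∏ Γ(a_i + α_i)`. -/
def foxHConst {p m : ℕ} (A : Fin p → ℝ × ℝ) (B : Fin m → ℝ × ℝ) : ℝ :=
  (∏ j, Real.Gamma ((B j).1 + (B j).2)) / ∏ i, Real.Gamma ((A i).1 + (A i).2)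

/-- `a* = ∑ β_j - ∑ α_i`. -/
def foxHAStar {p m : ℕ} (A : Fin p → ℝ × ℝ) (B : Fin m → ℝ × ℝ) : ℝ :=
  ∑ j, (B j).2 - ∑ i, (A i).2

/-- `μ = ∑ b_j - ∑ a_i + (p - q) / 2` with `q = m`. -/
def foxHMu {p m : ℕ} (A : Fin p → ℝ × ℝ) (B : Fin m → ℝ × ℝ) : ℝ :=
  ∑ j, (B j).1 - ∑ i, (A i).1 + ((p : ℝ) - (m : ℝ)) / 2

/-- The assumptions on the parameters under which `H^{m,0}_{p,m} / K` is a probability density on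
`(0, ∞)` with finite moments of all orders. -/
structure FoxHAdmissible {p m : ℕ} (A : Fin p → ℝ × ℝ) (B : Fin m → ℝ × ℝ) : Prop where
  upper_pos : ∀ i, 0 < (A i).2
  upper_add_pos : ∀ i, 0 < (A i).1 + (A i).2
  lower_pos : ∀ j, 0 < (B j).2
  lower_add_pos : ∀ j, 0 < (B j).1 + (B j).2
  aStar : 0 < foxHAStar A B ∨ (foxHAStar A B = 0 ∧ foxHMu A B < -1)
  nonneg : ∀ τ : ℝ, 0 < τ → 0 ≤ foxHm0 A B τ

/-- The real random variable `Y` has the density `H^{m,0}_{p,m} / K` on `(0, ∞)`. -/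
def HasFoxHDensity {p m : ℕ} (A : Fin p → ℝ × ℝ) (B : Fin m → ℝ × ℝ)
    {Ω : Type*} [MeasurableSpace Ω] (Y : Ω → ℝ) (P : Measure Ω) : Prop :=
  AEMeasurable Y P ∧
  P.map Y = (volume.restrict (Ioi (0 : ℝ))).withDensity
    (fun τ => ENNReal.ofReal (foxHm0 A B τ / foxHConst A B))

/-! ### The generalized Fox-H measure on the dual of the Schwartz space -/

/-- The space of real tempered distributions on the line. -/
abbrev RealTempered : Type := 𝓢(ℝ, ℝ) →L[ℝ] ℝ

/-- The cylinder σ-algebra. -/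
instance RealTempered.instMeasurableSpace : MeasurableSpace RealTempered :=
  ⨆ φ : 𝓢(ℝ, ℝ), MeasurableSpace.comap (fun ω : RealTempered => ω φ) inferInstance

/-- `μ` is the generalized Fox-H measure: the probability measure on the cylinder σ-algebra with
characteristic functional
`φ ↦ K⁻¹ · _mΨ_p[(b_j + β_j, β_j)_{1,m}; (a_i + α_i, α_i)_{1,p} | -⟨φ, φ⟩ / 2]`. -/
structure IsFoxHMeasure {p m : ℕ} (A : Fin p → ℝ × ℝ) (B : Fin m → ℝ × ℝ)
    (μ : Measure RealTempered) : Prop where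
  isProbabilityMeasure : IsProbabilityMeasure μ
  charFun_eq : ∀ φ : 𝓢(ℝ, ℝ),
    ∫ ω : RealTempered, Complex.exp (Complex.I * ((ω φ : ℝ) : ℂ)) ∂μ =
      ((1 / foxHConst A B *
        genWright (fun j => ((B j).1 + (B j).2, (B j).2)) (fun i => ((A i).1 + (A i).2, (A i).2))
          (-(∫ x : ℝ, φ x * φ x) / 2) : ℝ) : ℂ)

/-- `X` is a version of the extended dual pairing `⟨·, f⟩`, `f ∈ L²(ℝ)`: the `L²(μ)`-limit of
`⟨·, φ_n⟩` for Schwartz functions `φ_n` that converge to `f` in `L²(ℝ)`. -/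
def IsDualPairing (μ : Measure RealTempered) (f : ℝ → ℝ) (X : RealTempered → ℝ) : Prop :=
  MemLp X 2 μ ∧ ∃ φ : ℕ → 𝓢(ℝ, ℝ),
    Tendsto (fun n => eLpNorm (fun x => φ n x - f x) 2 volume) atTop (𝓝 0) ∧
    Tendsto (fun n => eLpNorm (fun ω : RealTempered => ω (φ n) - X ω) 2 μ) atTop (𝓝 0)

open Classical in
/-- The extended dual pairing `ω ↦ ⟨ω, f⟩`, determined up to `μ`-null sets. -/
def dualPairing (μ : Measure RealTempered) (f : ℝ → ℝ) : RealTempered → ℝ :=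
  if h : ∃ X : RealTempered → ℝ, IsDualPairing μ f X then h.choose else 0

/-! ### Fractional operators and the generalized Fox-H process -/

/-- The right-sided Riemann-Liouville fractional integral `I^σ_-`. -/
def rlIntegralMinus (σ : ℝ) (f : ℝ → ℝ) (x : ℝ) : ℝ :=
  1 / Real.Gamma σ * ∫ t in Ioi x, f t * (t - x) ^ (σ - 1)

/-- The right-sided Riemann-Liouville fractional derivative `D^σ_-`. -/
def rlDerivMinus (σ : ℝ) (f : ℝ → ℝ) (x : ℝ) : ℝ :=
  -(1 / Real.Gamma (1 - σ)) * deriv (fun y : ℝ => ∫ t in Ioi y, f t * (t - y) ^ (-σ)) x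

/-- The normalizing constant `K_H`. -/
def hurstConst (H : ℝ) : ℝ :=
  Real.Gamma (H + 1 / 2) *
    ((∫ s in Ioi (0 : ℝ), ((1 + s) ^ (H - 1 / 2) - s ^ (H - 1 / 2)) ^ 2) + 1 / (2 * H)) ^
      (-(1 / 2) : ℝ)

/-- The operator `M^H_-`. -/
def fracOpMinus (H : ℝ) (f : ℝ → ℝ) : ℝ → ℝ :=
  if H < 1 / 2 then fun x => hurstConst H * rlDerivMinus (-(H - 1 / 2)) f x
  else if H = 1 / 2 then f
  else fun x => hurstConst H * rlIntegralMinus (H - 1 / 2) f x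

/-- The generalized Fox-H process `X_t = ⟨·, M^H_- 1_{[0,t)}⟩`, `t ≥ 0`, on the probability space
of the generalized Fox-H measure `μ`. -/
def foxHProcess (H : ℝ) (μ : Measure RealTempered) (t : ℝ≥0) : RealTempered → ℝ :=
  dualPairing μ (fracOpMinus H (indicator (Ico (0 : ℝ) (t : ℝ)) (fun _ => (1 : ℝ))))

/-! ### Fractional Brownian motion and equality of finite-dimensional distributions -/

/-- Fractional Brownian motion with Hurst parameter `H`: a centered Gaussian process with the
covariance `(s^{2H} + t^{2H} - |s - t|^{2H}) / 2` and almost surely continuous paths. -/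
structure IsFractionalBrownianMotion (H : ℝ) {Ω : Type*} [MeasurableSpace Ω]
    (X : ℝ≥0 → Ω → ℝ) (P : Measure Ω) : Prop where
  isGaussianProcess : IsGaussianProcess X P
  integral_eq_zero : ∀ t, ∫ ω, X t ω ∂P = 0
  covariance_eq : ∀ s t : ℝ≥0, cov[X s, X t; P] =
    1 / 2 * ((s : ℝ) ^ (2 * H) + (t : ℝ) ^ (2 * H) - |(s : ℝ) - (t : ℝ)| ^ (2 * H))
  cont : ∀ᵐ ω ∂P, Continuous (fun t => X t ω)

/-- Two processes, possibly on different probability spaces, have the same finite-dimensional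
distributions. -/
def EqualFDD {T Ω Ω' : Type*} [MeasurableSpace Ω] [MeasurableSpace Ω']
    (X : T → Ω → ℝ) (μ : Measure Ω) (Z : T → Ω' → ℝ) (P : Measure Ω') : Prop :=
  ∀ (n : ℕ) (t : Fin n → T),
    IdentDistrib (fun ω i => X (t i) ω) (fun ω i => Z (t i) ω) μ P

end

/-! ### Exponential integrability from analytic characteristic functions -/

/-! All three families of finite-dimensional distributions are mixtures of centred Gaussian laws,
with `Y` as the random scale of the variance. Fix times `t i` and coefficients `c i`, and let `V =
fbmVar H t c` be the variance of `∑ c i * B (t i)`. The characteristic function of each of the three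
linear combinations is the Laplace transform `E exp (-(V / 2) * Y)`, and this determines the laws.
For `√Y * B` one integrates out `B` with `Y` frozen. For the time-changed motion, self-similarity
multiplies `V` by `(Y ^ (1 / (2H))) ^ (2H) = Y`. For the Fox-H process, the linear combination is
the pairing with `∑ c i * M 1_[0, t i)`. Up to null sets these functions are normalized
Mandelbrot-Van Ness kernels, so the squared `L²` norm of the sum is `V`
(`integral_fracIndicator_mul`), and Schwartz approximation transfers the characteristic functional
to it.

What remains is `HasFoxHDensity.laplace`: the Laplace transform of `Y` is the normalized Wright
function. Where the Wright series converges absolutely, `exp (-r * Y)` is expanded into moments.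
Elsewhere `exp (-r * Y)` is written as the inverse Mellin integral of `Γ(s) * (r * Y) ^ (-s)` and
the order of integration is exchanged. Both need `E Y ^ z` on the whole half-plane to the right of
the poles, whereas the density is an inverse Mellin transform along one unspecified line.

Nonnegativity of the density closes this gap without moving a contour. A continuous integrable
function with nonnegative Fourier transform has an integrable transform, so Mellin inversion holds
on that one line (`mellin_of_mellinInv_nonneg`). Then `E exp (z * log Y)` agrees with the
holomorphic Gamma quotient there. By Landau's argument, a positive measure has exponential moments
as far as its transform continues holomorphically, so the identity spreads to the half-plane
(`complexMGF_eq_of_eq_on_line`). -/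

theorem tendsto_second_difference {G : ℂ → ℂ} {s : Set ℂ} {z : ℂ} (hs : IsOpen s) (hz : z ∈ s)
    (hG : DifferentiableOn ℂ G s) :
    Tendsto (fun h : ℂ => (G (z + h) + G (z - h) - 2 * G z) / h ^ 2) (𝓝[≠] 0)
      (𝓝 (deriv (deriv G) z)) := by
  have hsz : s ∈ 𝓝 z := hs.mem_nhds hz
  -- Two successive slopes give `G (z ± h) = G z ± h * A z + h ^ 2 * B (z ± h)`, so the quotient is
  -- exactly `B (z + h) + B (z - h)`, and `2 * B z` is the second derivative.
  set A := dslope G z with hA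
  have hAd : DifferentiableOn ℂ A s := (Complex.differentiableOn_dslope hsz).2 hG
  set B := dslope A z with hB
  have hBd : DifferentiableOn ℂ B s := (Complex.differentiableOn_dslope hsz).2 hAd
  have hGA : ∀ w, G w = G z + (w - z) * A w := fun w => by
    have := sub_smul_dslope G z w
    rw [smul_eq_mul] at this
    rw [hA, this]; ring
  have hAB : ∀ w, A w = A z + (w - z) * B w := fun w => by
    have := sub_smul_dslope A z w
    rw [smul_eq_mul] at this
    rw [hB, this]; ring
  have hBc : ContinuousAt B z := (hBd.differentiableAt hsz).continuousAt
  have hBz : B z = deriv A z := by simp [hB]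
  have hG1 : ∀ w ∈ s, deriv G w = A w + (w - z) * deriv A w := fun w hw => by
    have h1 : HasDerivAt A (deriv A w) w := (hAd.differentiableAt (hs.mem_nhds hw)).hasDerivAt
    have h2 : HasDerivAt (fun w => G z + (w - z) * A w) (1 * A w + (w - z) * deriv A w) w :=
      (((hasDerivAt_id w).sub_const z).mul h1).const_add _
    have h3 : G = fun w => G z + (w - z) * A w := funext hGA
    rw [h3, h2.deriv, one_mul]
  have hG2 : deriv (deriv G) z = 2 * B z := by
    have h1 : HasDerivAt A (deriv A z) z := (hAd.differentiableAt hsz).hasDerivAt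
    have h1' : HasDerivAt (deriv A) (deriv (deriv A) z) z :=
      ((hAd.deriv hs).differentiableAt hsz).hasDerivAt
    have h2 := h1.add (((hasDerivAt_id z).sub_const z).mul h1')
    have h3 : deriv G =ᶠ[𝓝 z] (A + (fun w => id w - z) * deriv A) := by
      filter_upwards [hsz] with w hw
      simp [hG1 w hw]
    rw [h3.deriv_eq, h2.deriv, hBz]
    simp; ring
  have h0 : Tendsto (fun h : ℂ => B (z + h) + B (z - h)) (𝓝[≠] 0) (𝓝 (2 * B z)) := by
    have e1 : Tendsto (fun h : ℂ => z + h) (𝓝[≠] 0) (𝓝 z) := by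
      have : Tendsto (fun h : ℂ => z + h) (𝓝 0) (𝓝 (z + 0)) := by
        exact (continuous_const.add continuous_id).tendsto 0
      rw [add_zero] at this
      exact this.mono_left nhdsWithin_le_nhds
    have e2 : Tendsto (fun h : ℂ => z - h) (𝓝[≠] 0) (𝓝 z) := by
      have : Tendsto (fun h : ℂ => z - h) (𝓝 0) (𝓝 (z - 0)) := by
        exact (continuous_const.sub continuous_id).tendsto 0
      rw [sub_zero] at this
      exact this.mono_left nhdsWithin_le_nhds
    have := (hBc.tendsto.comp e1).add (hBc.tendsto.comp e2)
    rw [two_mul]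
    exact this
  rw [hG2]
  refine h0.congr' ?_
  filter_upwards [self_mem_nhdsWithin] with h hh
  have hh' : h ≠ 0 := hh
  rw [eq_div_iff (by positivity), hGA (z + h), hGA (z - h), hAB (z + h), hAB (z - h)]
  ring

/-- The second difference quotient of `cos` is nonnegative and at most `x ^ 2`. -/
theorem two_sub_two_cos_div_sq_mem (h x : ℝ) :
    0 ≤ (2 - 2 * Real.cos (h * x)) / h ^ 2 ∧ (2 - 2 * Real.cos (h * x)) / h ^ 2 ≤ x ^ 2 := by
  constructor
  · apply div_nonneg _ (sq_nonneg _)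
    linarith [Real.cos_le_one (h * x)]
  · rcases eq_or_ne h 0 with rfl | hh
    · simp; positivity
    · rw [div_le_iff₀ (by positivity)]
      have := Real.one_sub_sq_div_two_le_cos (x := h * x)
      nlinarith

/-- The increment is `h * I` because the characteristic function at `t` is the value of `G` at `t *
I`. The sign of `I ^ 2` makes the resulting weight nonnegative, which is what Fatou's lemma needs.
-/
theorem cexp_second_difference (t h x : ℝ) :
    (Complex.exp (((t + h : ℝ) : ℂ) * x * Complex.I) +
      Complex.exp (((t - h : ℝ) : ℂ) * x * Complex.I) - 2 * Complex.exp (t * x * Complex.I)) /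
      ((h : ℂ) * Complex.I) ^ 2 =
    ((2 - 2 * Real.cos (h * x)) / h ^ 2 : ℝ) * Complex.exp (t * x * Complex.I) := by
  have h1 : Complex.exp (((t + h : ℝ) : ℂ) * x * Complex.I) =
      Complex.exp (t * x * Complex.I) * Complex.exp ((h * x : ℝ) * Complex.I) := by
    rw [← Complex.exp_add]; push_cast; ring_nf
  have h2 : Complex.exp (((t - h : ℝ) : ℂ) * x * Complex.I) =
      Complex.exp (t * x * Complex.I) * Complex.exp (-(h * x : ℝ) * Complex.I) := by
    rw [← Complex.exp_add]; push_cast; ring_nf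
  have h3 := Complex.two_cos ((h * x : ℝ) : ℂ)
  rw [h1, h2, mul_pow, Complex.I_sq]
  push_cast at h3 ⊢
  rw [h3]
  ring

theorem tendsto_two_sub_two_cos_div_sq (x : ℝ) {u : ℕ → ℝ} (hu : Tendsto u atTop (𝓝[≠] 0)) :
    Tendsto (fun n => (2 - 2 * Real.cos (u n * x)) / u n ^ 2) atTop (𝓝 (x ^ 2)) := by
  have h1 : HasDerivAt (fun h : ℝ => Real.sin (h * (x / 2))) (x / 2) 0 := by
    have := ((hasDerivAt_id (0 : ℝ)).mul_const (x / 2)).sin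
    simpa using this
  have h2 := (hasDerivAt_iff_tendsto_slope_zero.1 h1).comp hu
  have h3 := (h2.pow 2).const_mul 4
  have h4 : 4 * (x / 2) ^ 2 = x ^ 2 := by ring
  rw [h4] at h3
  refine h3.congr fun n => ?_
  have h5 : Real.cos (u n * x) = 1 - 2 * Real.sin (u n * (x / 2)) ^ 2 := by
    rw [show u n * x = 2 * (u n * (x / 2)) by ring, Real.cos_two_mul, Real.cos_sq']; ring
  simp only [Function.comp, zero_add, zero_mul, Real.sin_zero, sub_zero, smul_eq_mul, h5]
  rw [div_eq_mul_inv]; ring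

/-- If a weighted characteristic function is the restriction of a holomorphic function, then the
weight has a second moment, which is again given by a holomorphic function. -/
theorem integrable_sq_mul_of_charFun {Ω : Type*} [MeasurableSpace Ω] {P : Measure Ω}
    {w X : Ω → ℝ} (hw : Integrable w P) (hw0 : ∀ ω, 0 ≤ w ω) (hX : AEMeasurable X P) {R : ℝ}
    (hR : 0 < R) {G : ℂ → ℂ} (hG : DifferentiableOn ℂ G (Metric.ball 0 R))
    (hφ : ∀ t : ℝ, |t| < R →
      ∫ ω, (w ω : ℂ) * Complex.exp (t * X ω * Complex.I) ∂P = G (t * Complex.I)) :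
    Integrable (fun ω => X ω ^ 2 * w ω) P ∧ ∀ t : ℝ, |t| < R →
      ∫ ω, ((X ω ^ 2 * w ω : ℝ) : ℂ) * Complex.exp (t * X ω * Complex.I) ∂P =
        deriv (deriv G) (t * Complex.I) := by
  have hint : ∀ t : ℝ, Integrable (fun ω => (w ω : ℂ) * Complex.exp (t * X ω * Complex.I)) P := by
    intro t
    refine (hw.ofReal (𝕜 := ℂ)).mul_bdd (c := 1) ?_ ?_
    · have : AEMeasurable (fun ω => Complex.exp (t * X ω * Complex.I)) P := by fun_prop
      exact this.aestronglyMeasurable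
    · filter_upwards with ω
      rw [show (t : ℂ) * X ω * Complex.I = ((t * X ω : ℝ) : ℂ) * Complex.I by push_cast; ring,
        Complex.norm_exp_ofReal_mul_I]
  let k : ℝ → ℝ → ℝ := fun h x => (2 - 2 * Real.cos (h * x)) / h ^ 2
  have hkm : ∀ h, Measurable (k h) := fun h => by
    have : Continuous (k h) := by fun_prop
    exact this.measurable
  have hlim : ∀ t : ℝ, |t| < R → ∀ u : ℕ → ℝ, Tendsto u atTop (𝓝[≠] 0) →
      Tendsto (fun n => ∫ ω, ((w ω * k (u n) (X ω) : ℝ) : ℂ) *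
        Complex.exp (t * X ω * Complex.I) ∂P) atTop (𝓝 (deriv (deriv G) (t * Complex.I))) := by
    intro t ht u hu
    have hu1 : Tendsto (fun n => (u n : ℂ) * Complex.I) atTop (𝓝[≠] 0) := by
      rw [tendsto_nhdsWithin_iff] at hu ⊢
      refine ⟨?_, ?_⟩
      · have : Tendsto (fun n => (u n : ℂ) * Complex.I) atTop (𝓝 (((0 : ℝ) : ℂ) * Complex.I)) :=
          (Complex.continuous_ofReal.continuousAt.tendsto.comp hu.1).mul_const _
        simpa using this
      · filter_upwards [hu.2] with n hn
        have : u n ≠ 0 := hn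
        simp [this]
    have hmem : (t : ℂ) * Complex.I ∈ Metric.ball (0 : ℂ) R := by simpa using ht
    have h1 := (tendsto_second_difference Metric.isOpen_ball hmem hG).comp hu1
    refine h1.congr' ?_
    have hu0 : Tendsto u atTop (𝓝 0) := hu.mono_right nhdsWithin_le_nhds
    have hsmall : ∀ᶠ n in atTop, |u n| < R - |t| :=
      (by simpa using hu0.abs : Tendsto (fun n => |u n|) atTop (𝓝 0)).eventually_lt_const
        (by linarith)
    filter_upwards [hsmall] with n hn
    have e1 : |t + u n| < R := (abs_add_le _ _).trans_lt (by linarith)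
    have e2 : |t - u n| < R := (abs_sub _ _).trans_lt (by linarith)
    simp only [Function.comp]
    have hadd := (hint (t + u n)).add (hint (t - u n))
    simp only [Pi.add_def] at hadd
    rw [show (t : ℂ) * Complex.I + u n * Complex.I = ((t + u n : ℝ) : ℂ) * Complex.I by
        push_cast; ring,
      show (t : ℂ) * Complex.I - u n * Complex.I = ((t - u n : ℝ) : ℂ) * Complex.I by
        push_cast; ring, ← hφ _ e1, ← hφ _ e2, ← hφ _ ht, ← integral_const_mul,
      ← integral_add (hint _) (hint _), ← integral_sub hadd
        ((hint _).const_mul _), ← integral_div]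
    refine integral_congr_ae (Eventually.of_forall fun ω => ?_)
    have := cexp_second_difference t (u n) (X ω)
    simp only [k]
    rw [Complex.ofReal_mul]
    linear_combination (w ω : ℂ) * this
  have hu : Tendsto (fun n : ℕ => 1 / ((n : ℝ) + 1)) atTop (𝓝[≠] 0) := by
    rw [tendsto_nhdsWithin_iff]
    refine ⟨tendsto_one_div_add_atTop_nhds_zero_nat, Eventually.of_forall fun n => ?_⟩
    have : (0 : ℝ) < 1 / ((n : ℝ) + 1) := by positivity
    exact this.ne'
  set u : ℕ → ℝ := fun n => 1 / ((n : ℝ) + 1) with hu_def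
  have hkint : ∀ n, Integrable (fun ω => w ω * k (u n) (X ω)) P := by
    intro n
    refine hw.mul_bdd (c := 4 / u n ^ 2) ((hkm _).comp_aemeasurable hX).aestronglyMeasurable ?_
    filter_upwards with ω
    rw [Real.norm_of_nonneg (two_sub_two_cos_div_sq_mem _ _).1]
    gcongr
    linarith [Real.neg_one_le_cos (u n * X ω)]
  have hmeas : AEStronglyMeasurable (fun ω => X ω ^ 2 * w ω) P :=
    (hX.pow_const 2).aestronglyMeasurable.mul hw.1
  have hsq : Integrable (fun ω => X ω ^ 2 * w ω) P := by
    refine ⟨hmeas, ?_⟩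
    rw [hasFiniteIntegral_iff_ofReal (Eventually.of_forall fun ω =>
      mul_nonneg (sq_nonneg _) (hw0 ω))]
    -- At `t = 0` the integrands are nonnegative and their integrals converge to `G''(0)`, so Fatou
    -- bounds the second moment.
    have h0 := hlim 0 (by simpa using hR) u hu
    have h0' : Tendsto (fun n => ∫ ω, w ω * k (u n) (X ω) ∂P) atTop
        (𝓝 (deriv (deriv G) 0).re) := by
      have := (Complex.continuous_re.tendsto _).comp h0
      simp only [Complex.ofReal_zero, zero_mul] at this
      refine this.congr fun n => ?_
      simp only [Function.comp, Complex.exp_zero, mul_one]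
      rw [integral_complex_ofReal]
      exact Complex.ofReal_re _
    have h1 : ∀ ω, Tendsto (fun n => ENNReal.ofReal (w ω * k (u n) (X ω))) atTop
        (𝓝 (ENNReal.ofReal (X ω ^ 2 * w ω))) := fun ω => by
      rw [mul_comm]
      exact ENNReal.tendsto_ofReal ((tendsto_two_sub_two_cos_div_sq (X ω) hu).const_mul _)
    calc ∫⁻ ω, ENNReal.ofReal (X ω ^ 2 * w ω) ∂P
        = ∫⁻ ω, liminf (fun n => ENNReal.ofReal (w ω * k (u n) (X ω))) atTop ∂P :=
          lintegral_congr fun ω => (h1 ω).liminf_eq.symm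
      _ ≤ liminf (fun n => ∫⁻ ω, ENNReal.ofReal (w ω * k (u n) (X ω)) ∂P) atTop :=
          lintegral_liminf_le' fun n => (hkint n).1.aemeasurable.ennreal_ofReal
      _ = liminf (fun n => ENNReal.ofReal (∫ ω, w ω * k (u n) (X ω) ∂P)) atTop := by
          congr 1; ext n
          rw [ofReal_integral_eq_lintegral_ofReal (hkint n) (Eventually.of_forall fun ω =>
            mul_nonneg (hw0 ω) (two_sub_two_cos_div_sq_mem _ _).1)]
      _ = ENNReal.ofReal (deriv (deriv G) 0).re := (ENNReal.tendsto_ofReal h0').liminf_eq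
      _ < ∞ := ENNReal.ofReal_lt_top
  refine ⟨hsq, fun t ht => ?_⟩
  -- With the second moment finite, `X ^ 2 * w` dominates every difference quotient, and the limit
  -- can be taken under the integral at each `t`.
  refine tendsto_nhds_unique ?_ (hlim t ht u hu)
  refine tendsto_integral_of_dominated_convergence (fun ω => X ω ^ 2 * w ω) ?_ hsq ?_ ?_
  · intro n
    have : AEMeasurable (fun ω => Complex.exp (t * X ω * Complex.I)) P := by fun_prop
    exact (Complex.continuous_ofReal.comp_aestronglyMeasurable (hkint n).1).mul this.aestronglyMeasurable
  · intro n
    filter_upwards with ω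
    rw [norm_mul, show (t : ℂ) * X ω * Complex.I = ((t * X ω : ℝ) : ℂ) * Complex.I by
      push_cast; ring, Complex.norm_exp_ofReal_mul_I, mul_one, Complex.norm_real,
      Real.norm_of_nonneg (mul_nonneg (hw0 ω) (two_sub_two_cos_div_sq_mem _ _).1), mul_comm]
    exact mul_le_mul_of_nonneg_right (two_sub_two_cos_div_sq_mem _ _).2 (hw0 ω)
  · filter_upwards with ω
    refine Tendsto.mul_const _ ?_
    rw [mul_comm (X ω ^ 2)]
    exact (Complex.continuous_ofReal.tendsto _).comp
      ((tendsto_two_sub_two_cos_div_sq (X ω) hu).const_mul _)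

/-- Induction with `X ^ (2 * k) * w` as the new weight; this is the reason for carrying a weight at
all. Only even powers keep it nonnegative. -/
theorem integrable_pow_mul_of_charFun {Ω : Type*} [MeasurableSpace Ω] {P : Measure Ω}
    {w X : Ω → ℝ} (hw : Integrable w P) (hw0 : ∀ ω, 0 ≤ w ω) (hX : AEMeasurable X P) {R : ℝ}
    (hR : 0 < R) {G : ℂ → ℂ} (hG : DifferentiableOn ℂ G (Metric.ball 0 R))
    (hφ : ∀ t : ℝ, |t| < R →
      ∫ ω, (w ω : ℂ) * Complex.exp (t * X ω * Complex.I) ∂P = G (t * Complex.I)) (k : ℕ) :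
    Integrable (fun ω => X ω ^ (2 * k) * w ω) P ∧
    DifferentiableOn ℂ (iteratedDeriv (2 * k) G) (Metric.ball 0 R) ∧ ∀ t : ℝ, |t| < R →
      ∫ ω, ((X ω ^ (2 * k) * w ω : ℝ) : ℂ) * Complex.exp (t * X ω * Complex.I) ∂P =
        iteratedDeriv (2 * k) G (t * Complex.I) := by
  induction k with
  | zero => simpa using ⟨hw, hG, hφ⟩
  | succ k ih =>
    obtain ⟨h1, h2, h3⟩ := ih
    have h4 := integrable_sq_mul_of_charFun h1
      (fun ω => mul_nonneg ((even_two_mul k).pow_nonneg _) (hw0 ω)) hX hR h2 h3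
    have e : iteratedDeriv (2 * (k + 1)) G = deriv (deriv (iteratedDeriv (2 * k) G)) := by
      rw [show 2 * (k + 1) = 2 * k + 1 + 1 by ring, iteratedDeriv_succ, iteratedDeriv_succ]
    have e2 : ∀ ω, X ω ^ (2 * (k + 1)) * w ω = X ω ^ 2 * (X ω ^ (2 * k) * w ω) := fun ω => by ring
    simp only [e, e2]
    exact ⟨h4.1, (h2.deriv Metric.isOpen_ball).deriv Metric.isOpen_ball, h4.2⟩

/-- Landau's argument: a finite measure whose Fourier transform extends to a holomorphic function
on a disc has exponential moments up to the radius of the disc. -/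
theorem integrable_exp_mul_of_charFun {Ω : Type*} [MeasurableSpace Ω] {P : Measure Ω}
    {w X : Ω → ℝ} (hw : Integrable w P) (hw0 : ∀ ω, 0 ≤ w ω) (hX : AEMeasurable X P) {R : ℝ}
    {G : ℂ → ℂ} (hG : DifferentiableOn ℂ G (Metric.ball 0 R))
    (hφ : ∀ t : ℝ, |t| < R →
      ∫ ω, (w ω : ℂ) * Complex.exp (t * X ω * Complex.I) ∂P = G (t * Complex.I)) {r : ℝ}
    (hr : |r| < R) : Integrable (fun ω => Real.exp (r * X ω) * w ω) P := by
  have hR : 0 < R := (abs_nonneg r).trans_lt hr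
  have hk := integrable_pow_mul_of_charFun hw hw0 hX hR hG hφ
  have hmem : (r : ℂ) ∈ Metric.ball (0 : ℂ) R := by simpa using hr
  -- The even part of the Taylor series of `G` at `r` converges, and its terms are the integrals of
  -- the terms of the `cosh (r * X)` series. These terms are nonnegative, so Tonelli makes `cosh (r
  -- * X) * w` integrable.
  have hs := (Complex.hasSum_taylorSeries_on_ball hG hmem).summable.comp_injective
    (i := fun k : ℕ => 2 * k) (fun a b h => by simpa using h)
  have hmom : ∀ k, iteratedDeriv (2 * k) G 0 = ((∫ ω, X ω ^ (2 * k) * w ω ∂P : ℝ) : ℂ) := by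
    intro k
    have := (hk k).2.2 0 (by simpa using hR)
    simp only [Complex.ofReal_zero, zero_mul, Complex.exp_zero, mul_one] at this
    rw [← this]
    exact integral_ofReal
  let c : ℕ → Ω → ℝ := fun k ω => r ^ (2 * k) / (2 * k).factorial * (X ω ^ (2 * k) * w ω)
  have hc0 : ∀ k ω, 0 ≤ c k ω := fun k ω =>
    mul_nonneg (div_nonneg ((even_two_mul k).pow_nonneg _) (Nat.cast_nonneg _))
      (mul_nonneg ((even_two_mul k).pow_nonneg _) (hw0 ω))
  have hcint : ∀ k, Integrable (c k) P := fun k => (hk k).1.const_mul _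
  have hsum : Summable (fun k => ∫ ω, c k ω ∂P) := by
    rw [← Complex.summable_ofReal]
    refine hs.congr fun k => ?_
    simp only [Function.comp, c, smul_eq_mul, sub_zero, hmom]
    rw [integral_const_mul]
    push_cast
    ring
  have hcosh : ∀ ω, HasSum (fun k => c k ω) (Real.cosh (r * X ω) * w ω) := by
    intro ω
    refine ((Real.hasSum_cosh (r * X ω)).mul_right (w ω)).congr_fun ?_
    intro k
    simp only [c, mul_pow]
    ring
  have hint : Integrable (fun ω => Real.cosh (r * X ω) * w ω) P := by
    refine ⟨?_, ?_⟩
    · have : AEMeasurable (fun ω => Real.cosh (r * X ω)) P :=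
        Real.continuous_cosh.measurable.comp_aemeasurable (hX.const_mul r)
      exact this.aestronglyMeasurable.mul hw.1
    · rw [hasFiniteIntegral_iff_ofReal (Eventually.of_forall fun ω =>
        mul_nonneg (Real.cosh_pos _).le (hw0 ω))]
      have e : ∀ ω, ENNReal.ofReal (Real.cosh (r * X ω) * w ω) =
          ∑' k, ENNReal.ofReal (c k ω) := fun ω => by
        rw [← (hcosh ω).tsum_eq, ENNReal.ofReal_tsum_of_nonneg (fun k => hc0 k ω)
          (hcosh ω).summable]
      rw [lintegral_congr e, lintegral_tsum fun k => (hcint k).1.aemeasurable.ennreal_ofReal]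
      simp_rw [← fun k => ofReal_integral_eq_lintegral_ofReal (hcint k)
        (Eventually.of_forall (hc0 k))]
      rw [← ENNReal.ofReal_tsum_of_nonneg (fun k => integral_nonneg (hc0 k)) hsum]
      exact ENNReal.ofReal_lt_top
  refine (hint.const_mul 2).mono' ?_ ?_
  · have : AEMeasurable (fun ω => Real.exp (r * X ω)) P := by fun_prop
    exact this.aestronglyMeasurable.mul hw.1
  · filter_upwards with ω
    rw [Real.norm_of_nonneg (mul_nonneg (Real.exp_pos _).le (hw0 ω)), Real.cosh_eq]
    have := mul_nonneg (Real.exp_pos (-(r * X ω))).le (hw0 ω)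
    linarith

/-! ### Nonnegative Fourier transforms and analytic continuation -/

open FourierTransform in
/-- An integrable function that is continuous at the origin and has a nonnegative Fourier transform
has an integrable Fourier transform. -/
theorem integrable_fourier_of_nonneg {f : ℝ → ℂ} (hf : Integrable f) (hc : ContinuousAt f 0)
    (him : ∀ u, (𝓕 f u).im = 0) (hre : ∀ u, 0 ≤ (𝓕 f u).re) : Integrable (𝓕 f) := by
  have hcont : Continuous (𝓕 f) := by
    exact VectorFourier.fourierIntegral_continuous Real.continuous_fourierChar
      (by exact continuous_inner) hf
  have hgauss : ∀ c : ℝ, 0 < c → Integrable (fun w : ℝ => Complex.exp (-(c : ℂ)⁻¹ * ‖w‖ ^ 2)) := by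
    intro c hc
    have := GaussianFourier.integrable_cexp_neg_mul_sq_norm_add (V := ℝ) (b := (c : ℂ)⁻¹)
      (by simpa [← Complex.ofReal_inv] using hc) 0 (0 : ℝ)
    simpa using this
  have hbdd : ∀ u, ‖𝓕 f u‖ ≤ ∫ x, ‖f x‖ := fun u => by
    exact VectorFourier.norm_fourierIntegral_le_integral_norm _ _ _ _ _
  have hint : ∀ c : ℝ, 0 < c →
      Integrable (fun w : ℝ => Complex.exp (-(c : ℂ)⁻¹ * ‖w‖ ^ 2) * 𝓕 f w) := fun c hc =>
    (hgauss c hc).mul_bdd hcont.aestronglyMeasurable (Eventually.of_forall hbdd)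
  have hlim : Tendsto (fun c : ℝ => ∫ w : ℝ, Complex.exp (-(c : ℂ)⁻¹ * ‖w‖ ^ 2) * 𝓕 f w) atTop
      (𝓝 (f 0)) := by
    -- The Gaussian means of `f` at the origin tend to `f 0`; self-adjointness of the Fourier
    -- transform rewrites them as Gaussian-damped integrals of `𝓕 f`.
    refine (Real.tendsto_integral_gaussian_smul' hf hc).congr' ?_
    filter_upwards [Ioi_mem_atTop 0] with c (hc : 0 < c)
    have e := VectorFourier.integral_fourierIntegral_smul_eq_flip (L := innerₗ ℝ)
      Real.continuous_fourierChar continuous_inner (hgauss c hc) hf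
    have e2 : ∫ ξ : ℝ, 𝓕 (fun w : ℝ => Complex.exp (-(c : ℂ)⁻¹ * ‖w‖ ^ 2)) ξ • f ξ =
        ∫ w : ℝ, Complex.exp (-(c : ℂ)⁻¹ * ‖w‖ ^ 2) • 𝓕 f w := by simpa using! e
    simp only [smul_eq_mul] at e2 ⊢
    rw [← e2]
    congr 1
    ext w
    have := fourier_gaussian_innerProductSpace' (V := ℝ) (b := (c : ℂ)⁻¹)
      (by simpa [← Complex.ofReal_inv] using hc) 0 w
    simp only [inner_zero_left, Complex.ofReal_zero, mul_zero, add_zero] at this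
    rw [this]
    simp
    left; left
    ring_nf
  have hnorm : ∀ u, ‖𝓕 f u‖ = (𝓕 f u).re := fun u => by
    conv_lhs => rw [← Complex.re_add_im (𝓕 f u), him u]
    simp [abs_of_nonneg (hre u)]
  refine ⟨hcont.aestronglyMeasurable, ?_⟩
  have hreal : ∀ (c : ℝ) (w : ℝ), (Complex.exp (-(c : ℂ)⁻¹ * ‖w‖ ^ 2) * 𝓕 f w).re =
      Real.exp (-c⁻¹ * ‖w‖ ^ 2) * (𝓕 f w).re := fun c w => by
    rw [show (-(c : ℂ)⁻¹ * ‖w‖ ^ 2) = ((-c⁻¹ * ‖w‖ ^ 2 : ℝ) : ℂ) by push_cast; ring,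
      ← Complex.ofReal_exp, Complex.re_ofReal_mul]
  have hlim' : Tendsto (fun n : ℕ => ∫ w : ℝ, Real.exp (-((n : ℝ) + 1)⁻¹ * ‖w‖ ^ 2) * (𝓕 f w).re)
      atTop (𝓝 (f 0).re) := by
    have h1 := (Complex.continuous_re.tendsto _).comp
      (hlim.comp (tendsto_atTop_add_const_right atTop (1 : ℝ) tendsto_natCast_atTop_atTop))
    refine h1.congr fun n => ?_
    simp only [Function.comp]
    rw [← RCLike.re_eq_complex_re, ← integral_re (hint _ (by positivity))]
    refine integral_congr_ae (Eventually.of_forall fun w => ?_)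
    exact hreal _ w
  have hint' : ∀ n : ℕ,
      Integrable (fun w : ℝ => Real.exp (-((n : ℝ) + 1)⁻¹ * ‖w‖ ^ 2) * (𝓕 f w).re) := fun n => by
    refine (hint ((n : ℝ) + 1) (by positivity)).re.congr (Eventually.of_forall fun w => ?_)
    exact hreal _ w
  have hpt : ∀ w, Tendsto (fun n : ℕ =>
      ENNReal.ofReal (Real.exp (-((n : ℝ) + 1)⁻¹ * ‖w‖ ^ 2) * (𝓕 f w).re)) atTop
      (𝓝 (ENNReal.ofReal (𝓕 f w).re)) := fun w => by
    refine ENNReal.tendsto_ofReal ?_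
    have h1 : Tendsto (fun n : ℕ => -((n : ℝ) + 1)⁻¹ * ‖w‖ ^ 2) atTop (𝓝 (-0 * ‖w‖ ^ 2)) := by
      have := (tendsto_one_div_add_atTop_nhds_zero_nat (𝕜 := ℝ)).neg.mul_const (‖w‖ ^ 2)
      simpa using this
    have h2 := ((Real.continuous_exp.tendsto _).comp h1).mul_const (𝓕 f w).re
    simpa using h2
  rw [HasFiniteIntegral]
  -- The damping factors tend to `1`, so Fatou bounds the integral of the nonnegative `𝓕 f` by `f
  -- 0`.
  calc ∫⁻ w, ‖𝓕 f w‖ₑ = ∫⁻ w, liminf (fun n : ℕ =>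
        ENNReal.ofReal (Real.exp (-((n : ℝ) + 1)⁻¹ * ‖w‖ ^ 2) * (𝓕 f w).re)) atTop :=
        lintegral_congr fun w => by rw [(hpt w).liminf_eq, ← hnorm, ofReal_norm]
    _ ≤ liminf (fun n : ℕ => ∫⁻ w,
        ENNReal.ofReal (Real.exp (-((n : ℝ) + 1)⁻¹ * ‖w‖ ^ 2) * (𝓕 f w).re)) atTop :=
        lintegral_liminf_le' fun n => (hint' n).1.aemeasurable.ennreal_ofReal
    _ = liminf (fun n : ℕ => ENNReal.ofReal
        (∫ w, Real.exp (-((n : ℝ) + 1)⁻¹ * ‖w‖ ^ 2) * (𝓕 f w).re)) atTop := by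
        congr 1; ext n
        rw [ofReal_integral_eq_lintegral_ofReal (hint' n) (Eventually.of_forall fun w =>
          mul_nonneg (Real.exp_pos _).le (hre w))]
    _ = ENNReal.ofReal (f 0).re := (ENNReal.tendsto_ofReal hlim').liminf_eq
    _ < ∞ := ENNReal.ofReal_lt_top

open FourierTransform in
theorem integrable_fourierInv_of_nonneg {f : ℝ → ℂ} (hf : Integrable f) (hc : ContinuousAt f 0)
    (him : ∀ u, (𝓕⁻ f u).im = 0) (hre : ∀ u, 0 ≤ (𝓕⁻ f u).re) : Integrable (𝓕⁻ f) := by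
  have e : 𝓕⁻ f = 𝓕 (fun x => f (-x)) := by
    ext u; rw [Real.fourierInv_eq_fourier_comp_neg]
  rw [e] at him hre ⊢
  refine integrable_fourier_of_nonneg hf.comp_neg ?_ him hre
  have : ContinuousAt f (-0) := by simpa using hc
  exact this.comp continuous_neg.continuousAt

/-- Analytic continuation of an exponential moment function: if the complex moment generating
function agrees with a holomorphic `G` on one vertical line of a right half-plane, then
it agrees with `G` on the whole half-plane. -/
theorem complexMGF_eq_of_eq_on_line {Ω : Type*} [MeasurableSpace Ω] {P : Measure Ω} {U : Ω → ℝ}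
    (hU : AEMeasurable U P) {D : Set ℝ} (hD : IsOpen D) (hDup : ∀ x ∈ D, ∀ y, x ≤ y → y ∈ D)
    {G : ℂ → ℂ} (hG : DifferentiableOn ℂ G {z | z.re ∈ D}) {x₀ : ℝ} (hx₀ : x₀ ∈ D)
    (hint : Integrable (fun ω => Real.exp (x₀ * U ω)) P)
    (hline : ∀ t : ℝ, complexMGF U P (x₀ + t * Complex.I) = G (x₀ + t * Complex.I)) :
    (D ⊆ interior (integrableExpSet U P)) ∧ ∀ z : ℂ, z.re ∈ D → complexMGF U P z = G z := by
  have hDconv : Convex ℝ D := by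
    rw [convex_iff_ordConnected]
    exact ⟨fun x hx y hy z hz => hDup x hx z hz.1⟩
  -- With the weight `exp (x * U)`, the vertical line through `x` becomes a Fourier transform that
  -- continues to `G (x + ·)` on a disc of radius `R`; exponential moments follow on the interval of
  -- that radius around `x`.
  have landau : ∀ x : ℝ, x ∈ integrableExpSet U P →
      (∀ t : ℝ, complexMGF U P (x + t * Complex.I) = G (x + t * Complex.I)) →
      ∀ R, Metric.ball x R ⊆ D → Metric.ball x R ⊆ integrableExpSet U P := by
    intro x hx hl R hR y hy
    have h1 := integrable_exp_mul_of_charFun (P := P) (w := fun ω => Real.exp (x * U ω)) (X := U)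
      (R := R) (G := fun z => G (x + z)) (r := y - x) hx (fun ω => (Real.exp_pos _).le) hU ?_ ?_
      (by simpa [Real.dist_eq] using hy)
    · refine h1.congr (Eventually.of_forall fun ω => ?_)
      simp only
      rw [← Real.exp_add]; ring_nf
    · intro z hz
      have hz' : (x + z : ℂ).re ∈ D := by
        apply hR
        rw [Metric.mem_ball, Real.dist_eq]
        have : (x + z : ℂ).re - x = z.re := by simp
        rw [this]
        exact (Complex.abs_re_le_norm z).trans_lt (by simpa using hz)
      have ho : {z : ℂ | z.re ∈ D} ∈ 𝓝 ((x : ℂ) + z) :=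
        (hD.preimage Complex.continuous_re).mem_nhds hz'
      have := hG.differentiableAt ho
      exact (this.comp z (by fun_prop)).differentiableWithinAt
    · intro t _
      rw [← hl t, complexMGF]
      refine integral_congr_ae (Eventually.of_forall fun ω => ?_)
      simp only
      rw [Complex.ofReal_exp, ← Complex.exp_add]
      congr 1; push_cast; ring
  have hx₀i : x₀ ∈ interior (integrableExpSet U P) := by
    obtain ⟨R, hR, hRD⟩ := Metric.isOpen_iff.1 hD x₀ hx₀
    exact mem_interior.2 ⟨_, landau x₀ hint hline R hRD, Metric.isOpen_ball,
      Metric.mem_ball_self hR⟩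
  have hconv : Convex ℝ (interior (integrableExpSet U P)) := convex_integrableExpSet.interior
  -- Identity theorem on a convex strip: the points `x₀ + I / (n + 1)` of the given line accumulate
  -- at `x₀`.
  have hident : ∀ z : ℂ, z.re ∈ interior (integrableExpSet U P) ∩ D →
      complexMGF U P z = G z := by
    set S : Set ℂ := {z | z.re ∈ interior (integrableExpSet U P) ∩ D} with hS
    have hSo : IsOpen S := (isOpen_interior.inter hD).preimage Complex.continuous_re
    have hSc : IsPreconnected S :=
      ((hconv.inter hDconv).linear_preimage Complex.reLm).isPreconnected
    have hx₀S : (x₀ : ℂ) ∈ S := by simpa [hS] using ⟨hx₀i, hx₀⟩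
    have h1 : AnalyticOnNhd ℂ (complexMGF U P) S := fun z hz => analyticAt_complexMGF hz.1
    have h2 : AnalyticOnNhd ℂ G S :=
      (hG.mono fun z hz => hz.2).analyticOnNhd hSo
    have h3 : ∃ᶠ z in 𝓝[≠] (x₀ : ℂ), complexMGF U P z = G z := by
      have ht : Tendsto (fun n : ℕ => (x₀ : ℂ) + ((1 / ((n : ℝ) + 1) : ℝ) : ℂ) * Complex.I) atTop
          (𝓝[≠] (x₀ : ℂ)) := by
        rw [tendsto_nhdsWithin_iff]
        constructor
        · have h4 : Tendsto (fun n : ℕ => (x₀ : ℂ) + ((1 / ((n : ℝ) + 1) : ℝ) : ℂ) * Complex.I)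
              atTop (𝓝 ((x₀ : ℂ) + ((0 : ℝ) : ℂ) * Complex.I)) :=
            (((Complex.continuous_ofReal.tendsto _).comp
              tendsto_one_div_add_atTop_nhds_zero_nat).mul_const _).const_add _
          simpa using h4
        · refine Eventually.of_forall fun n => ?_
          have : (n : ℂ) + 1 ≠ 0 := by exact_mod_cast n.succ_ne_zero
          simpa using this
      exact ht.frequently (Frequently.of_forall fun n => hline _)
    intro z hz
    exact h1.eqOn_of_preconnected_of_frequently_eq h2 hSc hx₀S h3 hz
  have hstep : ∀ x ∈ interior (integrableExpSet U P) ∩ D, ∀ R, Metric.ball x R ⊆ D →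
      Metric.ball x R ⊆ interior (integrableExpSet U P) ∩ D := by
    intro x hx R hR
    refine subset_inter (interior_maximal ?_ Metric.isOpen_ball) hR
    exact landau x (interior_subset hx.1)
      (fun t => hident _ (by simpa using hx)) R hR
  have hsub : D ⊆ interior (integrableExpSet U P) := by
    intro y hy
    obtain ⟨R, hR, hRD⟩ := Metric.isOpen_iff.1 hD y hy
    have hball : ∀ x, y ≤ x → Metric.ball x R ⊆ D := by
      intro x hx z hz
      have h1 : z - (x - y) ∈ D := hRD (by
        rw [Metric.mem_ball, Real.dist_eq] at hz ⊢
        rwa [show z - (x - y) - y = z - x by ring])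
      exact hDup _ h1 _ (by linarith)
    -- Since `D` is upward closed, a radius valid at one point is valid at every point to its right.
    -- So the steps have a fixed length: half the radius at `x₀` when moving right, half the radius
    -- at the target `y` when moving left, where `max` stops the walk at `y`.
    rcases le_total x₀ y with h | h
    · obtain ⟨R', hR', hRD'⟩ := Metric.isOpen_iff.1 hD x₀ hx₀
      have hball' : ∀ x, x₀ ≤ x → Metric.ball x R' ⊆ D := by
        intro x hx z hz
        have h1 : z - (x - x₀) ∈ D := hRD' (by
          rw [Metric.mem_ball, Real.dist_eq] at hz ⊢
          rwa [show z - (x - x₀) - x₀ = z - x by ring])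
        exact hDup _ h1 _ (by linarith)
      have hn : ∀ n : ℕ, x₀ + n * (R' / 2) ∈ interior (integrableExpSet U P) ∩ D := by
        intro n
        induction n with
        | zero => simpa using ⟨hx₀i, hx₀⟩
        | succ n ih =>
          refine hstep _ ih R' (hball' _ ?_) ?_
          · have : 0 ≤ (n : ℝ) * (R' / 2) := by positivity
            linarith
          · rw [Metric.mem_ball, Real.dist_eq]
            push_cast
            rw [show x₀ + (n + 1) * (R' / 2) - (x₀ + n * (R' / 2)) = R' / 2 by ring,
              abs_of_pos (by linarith)]
            linarith
      obtain ⟨n, hn'⟩ := exists_nat_ge ((y - x₀) / (R' / 2))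
      rw [div_le_iff₀ (by linarith)] at hn'
      exact (hconv.ordConnected.out hx₀i (hn n).1) ⟨h, by linarith⟩
    · have hn : ∀ n : ℕ, max y (x₀ - n * (R / 2)) ∈ interior (integrableExpSet U P) ∩ D := by
        intro n
        induction n with
        | zero => simpa [max_eq_right h] using ⟨hx₀i, hx₀⟩
        | succ n ih =>
          refine hstep _ ih R (hball _ (le_max_left _ _)) ?_
          rw [Metric.mem_ball, Real.dist_eq]
          refine (abs_max_sub_max_le_max _ _ _ _).trans_lt ?_
          push_cast
          rw [show x₀ - (n + 1) * (R / 2) - (x₀ - n * (R / 2)) = -(R / 2) by ring, sub_self,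
            abs_zero, abs_neg, abs_of_pos (by linarith)]
          exact max_lt hR (by linarith)
      obtain ⟨n, hn'⟩ := exists_nat_ge ((x₀ - y) / (R / 2))
      rw [div_le_iff₀ (by linarith)] at hn'
      have := (hn n).1
      rwa [max_eq_left (by linarith)] at this
  exact ⟨hsub, fun z hz => hident z ⟨hsub hz, hz⟩⟩

/-! ### Mellin inversion for nonnegative inverse Mellin transforms -/

open FourierTransform in
-- In the variable `log x` this is the inverse Fourier transform of an integrable function.
-- Continuity is what later makes the density measurable.
theorem mellinInv_continuousOn {F : ℂ → ℂ} {c : ℝ}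
    (hF : Integrable (fun y : ℝ => F (c + y * Complex.I))) :
    ContinuousOn (mellinInv c F) (Ioi 0) := by
  have h2π : 2 * Real.pi ≠ 0 := by positivity
  set f : ℝ → ℂ := fun y => F (c + 2 * Real.pi * y * Complex.I) with hf
  have hfint : Integrable f := by
    have := hF.comp_mul_left' h2π
    refine this.congr (Eventually.of_forall fun y => ?_)
    simp [hf]
  have hcont : Continuous (𝓕 f) := by
    exact VectorFourier.fourierIntegral_continuous Real.continuous_fourierChar
      (by exact continuous_inner) hfint
  have hcont' : Continuous (𝓕⁻ f) := by
    have e : 𝓕⁻ f = fun u => 𝓕 f (-u) := by ext u; rw [Real.fourierInv_eq_fourier_neg]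
    rw [e]; exact hcont.comp continuous_neg
  have h1 : ContinuousOn (fun x : ℝ => (x : ℂ) ^ (-c : ℂ) • 𝓕⁻ f (-Real.log x)) (Ioi 0) := by
    intro x hx
    have hx' : x ≠ 0 := (show (0 : ℝ) < x from hx).ne'
    refine ContinuousAt.continuousWithinAt ?_
    refine ContinuousAt.mul (M := ℂ) ?_ ?_
    · exact ContinuousAt.cpow Complex.continuous_ofReal.continuousAt continuousAt_const
        (Or.inl (by simpa using hx))
    · exact hcont'.continuousAt.comp (Real.continuousAt_log hx').neg
  exact h1.congr fun x hx => mellinInv_eq_fourierInv c F hx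

open FourierTransform in
/-- If the inverse Mellin transform `h` of an integrable function `F` is nonnegative, then the
Mellin transform of `h` converges and is equal to `F`. -/
theorem mellin_of_mellinInv_nonneg {F : ℂ → ℂ} {c : ℝ}
    (hF : Integrable (fun y : ℝ => F (c + y * Complex.I)))
    (hFc : Continuous (fun y : ℝ => F (c + y * Complex.I))) {h : ℝ → ℝ}
    (hh : ∀ x, 0 < x → mellinInv c F x = h x) (h0 : ∀ x, 0 < x → 0 ≤ h x) :
    MellinConvergent (fun x => (h x : ℂ)) c ∧
      ∀ t : ℝ, mellin (fun x => (h x : ℂ)) (c + t * Complex.I) = F (c + t * Complex.I) := by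
  have h2π : 2 * Real.pi ≠ 0 := by positivity
  set f : ℝ → ℂ := fun y => F (c + 2 * Real.pi * y * Complex.I) with hf
  have hfeq : f = fun y => (fun y : ℝ => F (c + y * Complex.I)) (2 * Real.pi * y) := by
    ext y; simp [hf]
  have hfint : Integrable f := by
    rw [hfeq]; exact hF.comp_mul_left' h2π
  have hfc : Continuous f := by
    rw [hfeq]; exact hFc.comp (continuous_const.mul continuous_id)
  set g : ℝ → ℂ := fun u => Real.exp (-c * u) • ((h (Real.exp (-u)) : ℝ) : ℂ) with hg
  have hinv : 𝓕⁻ f = g := by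
    ext u
    have h1 := mellinInv_eq_fourierInv c F (Real.exp_pos (-u))
    rw [hh _ (Real.exp_pos _), Real.log_exp, neg_neg, smul_eq_mul] at h1
    simp only [hg, h1]
    have h3 : Real.exp (-c * u) • ((Real.exp (-u) : ℂ) ^ (-c : ℂ) * 𝓕⁻ f u) = 𝓕⁻ f u := by
      rw [← Complex.ofReal_neg c, ← Complex.ofReal_cpow (Real.exp_pos _).le, ← Real.exp_mul,
        Complex.real_smul, ← mul_assoc, ← Complex.ofReal_mul, ← Real.exp_add]
      ring_nf
      simp
    exact h3.symm
  -- Nonnegativity of `h` enters here: it makes the inverse Fourier transform integrable, as Fourier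
  -- inversion requires.
  have hgint : Integrable g := by
    rw [← hinv]
    refine integrable_fourierInv_of_nonneg hfint hfc.continuousAt (fun u => ?_) (fun u => ?_)
    · rw [hinv]
      simp only [hg, Complex.real_smul, Complex.im_ofReal_mul, Complex.ofReal_im, mul_zero]
    · rw [hinv]
      simp only [hg, Complex.real_smul, Complex.re_ofReal_mul, Complex.ofReal_re]
      exact mul_nonneg (Real.exp_pos _).le (h0 _ (Real.exp_pos _))
  have himage : (Real.exp ∘ Neg.neg) '' univ = Ioi 0 := by
    rw [image_comp, image_univ_of_surjective neg_surjective, image_univ, Real.range_exp]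
  have hderiv : ∀ x ∈ univ, HasDerivWithinAt (Real.exp ∘ Neg.neg) (-Real.exp (-x)) univ x :=
    fun x _ => mul_neg_one (Real.exp (-x)) ▸
      ((Real.hasDerivAt_exp (-x)).comp x (hasDerivAt_neg x)).hasDerivWithinAt
  have hinj : univ.InjOn (Real.exp ∘ Neg.neg) :=
    Real.exp_injective.injOn.comp neg_injective.injOn (univ.mapsTo_univ _)
  refine ⟨?_, fun t => ?_⟩
  · rw [MellinConvergent, ← himage,
      integrableOn_image_iff_integrableOn_abs_deriv_smul MeasurableSet.univ hderiv hinj,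
      integrableOn_univ]
    refine hgint.congr (Eventually.of_forall fun u => ?_)
    simp only [hg, Function.comp, abs_neg, abs_of_pos (Real.exp_pos _), smul_eq_mul,
      Complex.real_smul]
    rw [← mul_assoc]
    congr 1
    rw [← Complex.ofReal_one, ← Complex.ofReal_sub, ← Complex.ofReal_cpow (Real.exp_pos _).le,
      ← Complex.ofReal_mul, ← Real.exp_mul, ← Real.exp_add]
    congr 2
    ring
  · rw [mellin_eq_fourier]
    have e1 : ((c : ℂ) + t * Complex.I).re = c := by simp
    have e2 : ((c : ℂ) + t * Complex.I).im = t := by simp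
    rw [e1, e2]
    have : 𝓕 (𝓕⁻ f) (t / (2 * Real.pi)) = f (t / (2 * Real.pi)) :=
      hfint.fourier_fourierInv_eq (by
        have : 𝓕 f = fun u => 𝓕⁻ f (-u) := by
          ext u; rw [Real.fourierInv_eq_fourier_neg, neg_neg]
        rw [this, hinv]; exact hgint.comp_neg) hfc.continuousAt
    rw [hinv] at this
    rw [this]
    simp only [hf]
    congr 2
    have hπ : (Real.pi : ℂ) ≠ 0 := by exact_mod_cast Real.pi_ne_zero
    push_cast
    field_simp

/-! ### The kernel of the Fox H-function -/

section Kernel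

variable {p m : ℕ} (A : Fin p → ℝ × ℝ) (B : Fin m → ℝ × ℝ)

theorem foxHKernel_lower (s : ℂ) : foxHKernel m 0 A B s =
    (∏ j, Complex.Gamma ((B j).1 + s * (B j).2)) /
      ∏ i, Complex.Gamma ((A i).1 + s * (A i).2) := by
  have h : (Finset.univ.filter fun j : Fin m => m ≤ j.val) = ∅ := by
    ext j; simp
  simp [foxHKernel, h]

/-- The abscissas of the vertical lines to the right of the poles of the kernel of `H^{m,0}`. -/
def foxHDomain : Set ℝ := {x | ∀ j, 0 < (B j).1 + x * (B j).2}

theorem isOpen_foxHDomain : IsOpen (foxHDomain B) := by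
  simp only [foxHDomain, Set.ofPred_forall]
  exact isOpen_iInter_of_finite fun j => isOpen_lt continuous_const (by fun_prop)

theorem foxHDomain_upward {x y : ℝ} (hB : ∀ j, 0 < (B j).2) (hx : x ∈ foxHDomain B) (hxy : x ≤ y) :
    y ∈ foxHDomain B := fun j => (hx j).trans_le (by
  have := mul_le_mul_of_nonneg_right hxy (hB j).le
  linarith)

/-- Only the numerator limits the half-plane, since `1 / Γ` is entire; the values `Γ = 0` at poles
and `0⁻¹ = 0` are consistent with this. -/
theorem differentiableOn_foxHKernel :
    DifferentiableOn ℂ (foxHKernel m 0 A B) {z | z.re ∈ foxHDomain B} := by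
  intro z hz
  have e : foxHKernel m 0 A B = fun s => (∏ j, Complex.Gamma ((B j).1 + s * (B j).2)) *
      ∏ i, (Complex.Gamma ((A i).1 + s * (A i).2))⁻¹ := by
    ext s
    rw [foxHKernel_lower, div_eq_mul_inv, Finset.prod_inv_distrib]
  rw [e]
  refine DifferentiableAt.differentiableWithinAt (DifferentiableAt.mul ?_ ?_)
  · refine DifferentiableAt.fun_finsetProd fun j _ => ?_
    refine DifferentiableAt.comp z (Complex.differentiableAt_Gamma _ fun n hn => ?_) (by fun_prop)
    have h1 := hz j
    have h2 := congrArg Complex.re hn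
    simp at h2
    have : (0 : ℝ) ≤ n := n.cast_nonneg
    linarith
  · refine DifferentiableAt.fun_finsetProd fun i _ => ?_
    have h1 : DifferentiableAt ℂ (fun s : ℂ => ((A i).1 : ℂ) + s * (A i).2) z := by fun_prop
    exact (Complex.differentiable_one_div_Gamma _).comp z h1

theorem foxHKernel_conj (s : ℂ) : foxHKernel m 0 A B ((starRingEnd ℂ) s) =
    (starRingEnd ℂ) (foxHKernel m 0 A B s) := by
  simp [foxHKernel_lower, ← Complex.Gamma_conj]

/-- Conjugation reflects the vertical line by `y ↦ -y`. Hence the real part taken in `foxHm0`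
discards nothing. -/
theorem mellinInv_im_eq_zero {F : ℂ → ℂ} (hF : ∀ s, F ((starRingEnd ℂ) s) = (starRingEnd ℂ) (F s))
    (c : ℝ) {x : ℝ} (hx : 0 < x) : (mellinInv c F x).im = 0 := by
  rw [← Complex.conj_eq_iff_im]
  simp only [mellinInv, Complex.real_smul, map_mul, Complex.conj_ofReal]
  congr 1
  rw [← integral_conj]
  rw [← integral_neg_eq_self]
  refine integral_congr_ae (Eventually.of_forall fun y => ?_)
  have hx' : (x : ℂ) ≠ 0 := by exact_mod_cast hx.ne'
  have e : ((c : ℂ) + ((-y : ℝ) : ℂ) * Complex.I) = (starRingEnd ℂ) (c + y * Complex.I) := by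
    simp
  simp only [smul_eq_mul, map_mul]
  rw [e, hF, Complex.conj_conj]
  congr 1
  rw [← map_neg, Complex.cpow_conj _ _ (by
    rw [Complex.arg_ofReal_of_nonneg hx.le]; exact Real.pi_pos.ne), Complex.conj_conj,
    Complex.conj_ofReal]

theorem foxHKernel_ofReal (x : ℝ) : foxHKernel m 0 A B x =
    (((∏ j, Real.Gamma ((B j).1 + x * (B j).2)) /
      ∏ i, Real.Gamma ((A i).1 + x * (A i).2) : ℝ) : ℂ) := by
  rw [foxHKernel_lower]
  push_cast
  congr 1 <;>
  · refine Finset.prod_congr rfl fun _ _ => ?_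
    rw [← Complex.Gamma_ofReal]; push_cast; rfl

variable {A B}

theorem FoxHAdmissible.one_mem_foxHDomain (hAB : FoxHAdmissible A B) : (1 : ℝ) ∈ foxHDomain B :=
  fun j => by simpa using hAB.lower_add_pos j

theorem FoxHAdmissible.foxHConst_pos (hAB : FoxHAdmissible A B) : 0 < foxHConst A B :=
  div_pos (Finset.prod_pos fun j _ => Real.Gamma_pos_of_pos (hAB.lower_add_pos j))
    (Finset.prod_pos fun i _ => Real.Gamma_pos_of_pos (hAB.upper_add_pos i))

/-- `H^{m,0}_{p,m}` as an inverse Mellin transform along some admissible line. -/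
theorem FoxHAdmissible.exists_foxHm0_eq (hAB : FoxHAdmissible A B) :
    ∃ c ∈ foxHDomain B, ∀ x, 0 < x → mellinInv c (foxHKernel m 0 A B) x = foxHm0 A B x := by
  have hex : ∃ c : ℝ, FoxHSeparates m 0 A B c :=
    ⟨1, fun j _ => hAB.one_mem_foxHDomain j, fun i hi => absurd hi (Nat.not_lt_zero _)⟩
  refine ⟨hex.choose, fun j => hex.choose_spec.1 j j.2, fun x hx => ?_⟩
  have him := mellinInv_im_eq_zero (foxHKernel_conj A B) hex.choose hx
  rw [foxHm0, foxH, dif_pos hex]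
  apply Complex.ext
  · simp
  · simpa using him

theorem continuous_foxHKernel_vertical {c : ℝ} (hc : c ∈ foxHDomain B) :
    Continuous (fun y : ℝ => foxHKernel m 0 A B (c + y * Complex.I)) := by
  have h1 : ContinuousOn (foxHKernel m 0 A B) {z | z.re ∈ foxHDomain B} :=
    (differentiableOn_foxHKernel A B).continuousOn
  refine h1.comp_continuous (by fun_prop) fun y => ?_
  simpa using hc

/-- Mellin inversion on the single line along which the density is defined. Integrability of the
kernel on it is deduced from the existence of `Y`, not from asymptotics of Gamma. -/
theorem HasFoxHDensity.exists_mellin_eq (hAB : FoxHAdmissible A B) {Ω : Type*} [MeasurableSpace Ω]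
    {P : Measure Ω} [IsProbabilityMeasure P] {Y : Ω → ℝ} (hY : HasFoxHDensity A B Y P) :
    ∃ c ∈ foxHDomain B, ContinuousOn (foxHm0 A B) (Ioi 0) ∧
      MellinConvergent (fun x => (foxHm0 A B x : ℂ)) c ∧
      ∀ t : ℝ, mellin (fun x => (foxHm0 A B x : ℂ)) (c + t * Complex.I) =
        foxHKernel m 0 A B (c + t * Complex.I) := by
  obtain ⟨c, hc, h⟩ := hAB.exists_foxHm0_eq
  have hint : Integrable (fun y : ℝ => foxHKernel m 0 A B (c + y * Complex.I)) := by
    -- On the line `x ^ (-s)` has constant modulus, so a non-integrable kernel would leave every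
    -- inversion integral undefined, hence `0`. The density would vanish and the law of `Y` would be
    -- the zero measure.
    by_contra hni
    have hz : ∀ x, 0 < x → foxHm0 A B x = 0 := fun x hx => by
      have hx' : (x : ℂ) ≠ 0 := by exact_mod_cast hx.ne'
      rw [← Complex.ofReal_eq_zero, ← h x hx, mellinInv, integral_undef, smul_zero]
      intro hi
      apply hni
      have hb : Continuous (fun y : ℝ => (x : ℂ) ^ ((c : ℂ) + y * Complex.I)) := by
        have : Continuous (fun y : ℝ => (c : ℂ) + y * Complex.I) := by fun_prop
        exact this.const_cpow (Or.inl hx')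
      refine (hi.bdd_mul (c := x ^ c) hb.aestronglyMeasurable
        (Eventually.of_forall fun y => ?_)).congr (Eventually.of_forall fun y => ?_)
      · rw [Complex.norm_cpow_eq_rpow_re_of_pos hx]; simp
      · simp only [smul_eq_mul]
        rw [← mul_assoc, ← Complex.cpow_add _ _ hx', add_neg_cancel, Complex.cpow_zero, one_mul]
    have h1 : P.map Y = 0 := by
      rw [hY.2, withDensity_eq_zero_iff (by
        refine AEMeasurable.congr (f := fun _ => (0 : ℝ≥0∞)) aemeasurable_const ?_
        filter_upwards [ae_restrict_mem measurableSet_Ioi] with x hx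
        simp [hz x hx])]
      filter_upwards [ae_restrict_mem measurableSet_Ioi] with x hx
      simp [hz x hx]
    have := Measure.isProbabilityMeasure_map (μ := P) hY.1
    exact this.ne_zero _ h1
  have hm := mellin_of_mellinInv_nonneg hint (continuous_foxHKernel_vertical hc) h hAB.nonneg
  refine ⟨c, hc, ?_, hm⟩
  refine ContinuousOn.congr (f := fun x => (mellinInv c (foxHKernel m 0 A B) x).re)
    (Complex.continuous_re.comp_continuousOn (mellinInv_continuousOn hint)) fun x hx => ?_
  simp only [h x hx, Complex.ofReal_re]

end Kernel

/-! ### Moments and Laplace transform of the Fox H-density -/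

section Moments

variable {p m : ℕ} {A : Fin p → ℝ × ℝ} {B : Fin m → ℝ × ℝ} {Ω : Type*} [MeasurableSpace Ω]
  {P : Measure Ω} [IsProbabilityMeasure P] {Y : Ω → ℝ}

omit [IsProbabilityMeasure P] in
theorem HasFoxHDensity.ae_pos (hY : HasFoxHDensity A B Y P) : ∀ᵐ ω ∂P, 0 < Y ω := by
  refine ae_of_ae_map hY.1 (p := fun y => 0 < y) ?_
  rw [hY.2]
  exact (withDensity_absolutelyContinuous _ _).ae_le (ae_restrict_mem measurableSet_Ioi)

theorem cexp_mul_log {τ : ℝ} (hτ : 0 < τ) (s : ℂ) :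
    Complex.exp (s * (Real.log τ : ℝ)) = (τ : ℂ) ^ s := by
  rw [Complex.cpow_def_of_ne_zero (by exact_mod_cast hτ.ne'), Complex.ofReal_log hτ.le, mul_comm]

/-- The Mellin transform of the Fox H-density. -/
theorem HasFoxHDensity.complexMGF_log (hAB : FoxHAdmissible A B) (hY : HasFoxHDensity A B Y P) :
    (∀ x, x + 1 ∈ foxHDomain B → Integrable (fun ω => Real.exp (x * Real.log (Y ω))) P) ∧
      ∀ z : ℂ, z.re + 1 ∈ foxHDomain B →
        complexMGF (fun ω => Real.log (Y ω)) P z = foxHKernel m 0 A B (z + 1) / foxHConst A B := by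
  obtain ⟨c, hc, hcont, hconv, hmellin⟩ := hY.exists_mellin_eq hAB
  have hK := hAB.foxHConst_pos
  set K := foxHConst A B with hKdef
  have hdm : AEMeasurable (fun τ => ENNReal.ofReal (foxHm0 A B τ / K))
      (volume.restrict (Ioi (0 : ℝ))) :=
    ((hcont.div_const K).aemeasurable measurableSet_Ioi).ennreal_ofReal
  have hmeas : ∀ s : ℂ, Measurable (fun τ : ℝ => Complex.exp (s * (Real.log τ : ℝ))) := fun s => by
    exact Complex.measurable_exp.comp
      ((Complex.measurable_ofReal.comp Real.measurable_log).const_mul s)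
  -- `E Y ^ s` is the Mellin transform of the density at `s + 1`, whence the shifts by one
  -- throughout.
  have hval : ∀ s : ℂ, ∀ τ ∈ Ioi (0 : ℝ), (ENNReal.ofReal (foxHm0 A B τ / K)).toReal •
      Complex.exp (s * (Real.log τ : ℝ)) = (τ : ℂ) ^ (s + 1 - 1) • (foxHm0 A B τ : ℂ) / K := by
    intro s τ hτ
    rw [ENNReal.toReal_ofReal (div_nonneg (hAB.nonneg τ hτ) hK.le), cexp_mul_log hτ,
      add_sub_cancel_right, Complex.real_smul, smul_eq_mul]
    push_cast
    ring
  have hint : Integrable (fun ω => Complex.exp (((c - 1 : ℝ) : ℂ) * (Real.log (Y ω) : ℝ))) P := by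
    refine (integrable_map_measure
      (g := fun τ : ℝ => Complex.exp (((c - 1 : ℝ) : ℂ) * (Real.log τ : ℝ)))
      (hmeas _).aestronglyMeasurable hY.1).1 ?_
    rw [hY.2, integrable_withDensity_iff_integrable_smul₀' hdm
      (Eventually.of_forall fun _ => ENNReal.ofReal_lt_top)]
    have h1 : IntegrableOn (fun τ : ℝ => (τ : ℂ) ^ (((c - 1 : ℝ) : ℂ) + 1 - 1) •
        (foxHm0 A B τ : ℂ) / K) (Ioi 0) := by
      have := Integrable.div_const hconv (K : ℂ)
      refine this.congr (Eventually.of_forall fun τ => ?_)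
      simp
    refine Integrable.congr h1 ?_
    filter_upwards [ae_restrict_mem measurableSet_Ioi] with τ hτ using (hval _ τ hτ).symm
  have hint' : Integrable (fun ω => Real.exp ((c - 1) * Real.log (Y ω))) P := by
    refine hint.re.congr (Eventually.of_forall fun ω => ?_)
    simp only [RCLike.re_eq_complex_re]
    rw [← Complex.ofReal_mul, ← Complex.ofReal_exp, Complex.ofReal_re]
  have hline : ∀ t : ℝ, complexMGF (fun ω => Real.log (Y ω)) P ((c - 1 : ℝ) + t * Complex.I) =
      foxHKernel m 0 A B (((c - 1 : ℝ) + t * Complex.I) + 1) / K := by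
    intro t
    have e : (((c - 1 : ℝ) : ℂ) + t * Complex.I) + 1 = c + t * Complex.I := by push_cast; ring
    rw [e, ← hmellin t, complexMGF, mellin, ← integral_div]
    rw [← integral_map (f := fun τ : ℝ =>
      Complex.exp ((((c - 1 : ℝ) : ℂ) + t * Complex.I) * (Real.log τ : ℝ))) hY.1
      (hmeas _).aestronglyMeasurable, hY.2,
      integral_withDensity_eq_integral_toReal_smul₀ hdm
        (Eventually.of_forall fun _ => ENNReal.ofReal_lt_top)]
    refine setIntegral_congr_fun measurableSet_Ioi fun τ hτ => ?_
    have := hval (((c - 1 : ℝ) : ℂ) + t * Complex.I) τ hτ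
    rw [e] at this
    exact this
  have h := complexMGF_eq_of_eq_on_line (P := P) (U := fun ω => Real.log (Y ω))
    (Real.measurable_log.comp_aemeasurable hY.1) (D := (fun x => x + 1) ⁻¹' foxHDomain B)
    ((isOpen_foxHDomain B).preimage (by fun_prop))
    (fun x hx y hxy => foxHDomain_upward B hAB.lower_pos hx (by simpa using hxy))
    (G := fun z => foxHKernel m 0 A B (z + 1) / K) ?_ (x₀ := c - 1) (by simpa using hc) hint' hline
  · exact ⟨fun x hx => integrable_of_mem_integrableExpSet (interior_subset (h.1 hx)), h.2⟩
  · intro z hz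
    have h1 : DifferentiableAt ℂ (foxHKernel m 0 A B) (z + 1) :=
      (differentiableOn_foxHKernel A B).differentiableAt
        (((isOpen_foxHDomain B).preimage Complex.continuous_re).mem_nhds (by simpa using hz))
    exact ((h1.comp z (by fun_prop : DifferentiableAt ℂ (fun z : ℂ => z + 1) z)).div_const
      (K : ℂ)).differentiableWithinAt

/-- The abscissa `k + 1` is admissible because the condition `0 < b_j + β_j` says that `1` is. -/
theorem HasFoxHDensity.integrable_pow (hAB : FoxHAdmissible A B) (hY : HasFoxHDensity A B Y P)
    (k : ℕ) : Integrable (fun ω => Y ω ^ k) P ∧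
      ∫ ω, Y ω ^ k ∂P = (∏ j, Real.Gamma ((B j).1 + (B j).2 + (B j).2 * k)) /
        (∏ i, Real.Gamma ((A i).1 + (A i).2 + (A i).2 * k)) / foxHConst A B := by
  have hk : (k : ℝ) + 1 ∈ foxHDomain B := foxHDomain_upward B hAB.lower_pos
    hAB.one_mem_foxHDomain (by linarith [k.cast_nonneg (α := ℝ)])
  have e : (fun ω => Real.exp (k * Real.log (Y ω))) =ᵐ[P] fun ω => Y ω ^ k := by
    filter_upwards [hY.ae_pos] with ω hω
    rw [← Real.log_pow, Real.exp_log (by positivity)]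
  refine ⟨((hY.complexMGF_log hAB).1 k hk).congr e, ?_⟩
  rw [← integral_congr_ae e]
  have h := (hY.complexMGF_log hAB).2 (k : ℝ) (by simpa using hk)
  rw [complexMGF_ofReal, ← Complex.ofReal_one, ← Complex.ofReal_add, foxHKernel_ofReal,
    ← Complex.ofReal_div, Complex.ofReal_inj, mgf] at h
  rw [h]
  congr 2 <;>
  · refine Finset.prod_congr rfl fun _ _ => ?_
    ring_nf

/-! ### Mellin inversion for the exponential function -/

theorem norm_Gamma_le {s : ℂ} (hs : 0 < s.re) : ‖Complex.Gamma s‖ ≤ Real.Gamma s.re := by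
  rw [Complex.Gamma_eq_integral hs, Real.Gamma_eq_integral hs, Complex.GammaIntegral]
  refine (norm_integral_le_integral_norm _).trans (le_of_eq ?_)
  refine setIntegral_congr_fun measurableSet_Ioi fun x hx => ?_
  simp only [norm_mul, Complex.norm_cpow_eq_rpow_re_of_pos hx, Complex.norm_real, Real.norm_eq_abs,
    abs_of_pos (Real.exp_pos _), Complex.sub_re, Complex.one_re]

theorem Gamma_ne_neg_nat {s : ℂ} (hs : 0 < s.re) (n : ℕ) : s ≠ -n := by
  intro h
  have := congrArg Complex.re h
  simp at this
  linarith [n.cast_nonneg (α := ℝ)]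

/-- Two uses of the functional equation give enough decay: `|Γ(s)| = |Γ(s + 2)| / (|s| |s + 1|) ≤
Γ(c + 2) / (c² + y²)`. -/
theorem verticalIntegrable_Gamma {c : ℝ} (hc : 0 < c) :
    Integrable (fun y : ℝ => Complex.Gamma (c + y * Complex.I)) := by
  have hcont : Continuous (fun y : ℝ => Complex.Gamma (c + y * Complex.I)) := by
    rw [continuous_iff_continuousAt]
    intro y
    refine ContinuousAt.comp (f := fun y : ℝ => (c : ℂ) + y * Complex.I)
      (Complex.continuousAt_Gamma _ (Gamma_ne_neg_nat (by simpa using hc))) ?_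
    exact Continuous.continuousAt (by fun_prop)
  set M : ℝ := Real.Gamma (c + 2) / min (c ^ 2) 1 with hM
  have hmin : 0 < min (c ^ 2) 1 := by positivity
  refine (integrable_inv_one_add_sq.const_mul M).mono' hcont.aestronglyMeasurable
    (Eventually.of_forall fun y => ?_)
  set s : ℂ := c + y * Complex.I with hs
  have hsre : s.re = c := by simp [hs]
  have hsim : s.im = y := by simp [hs]
  have hs0 : s ≠ 0 := fun h => by rw [h] at hsre; simp at hsre; linarith
  have hs1 : s + 1 ≠ 0 := fun h => by
    have := congrArg Complex.re h; simp [hsre] at this; linarith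
  have h1 : Complex.Gamma (s + 2) = (s + 1) * (s * Complex.Gamma s) := by
    rw [← Complex.Gamma_add_one s hs0, ← Complex.Gamma_add_one (s + 1) hs1]; ring_nf
  have h2 : ‖Complex.Gamma (s + 2)‖ ≤ Real.Gamma (c + 2) := by
    have := norm_Gamma_le (s := s + 2) (by simp [hsre]; linarith)
    simpa [hsre] using this
  have h3 : ‖s‖ ^ 2 = c ^ 2 + y ^ 2 := by
    rw [← Complex.normSq_eq_norm_sq, Complex.normSq_apply, hsre, hsim]; ring
  have h4 : ‖s‖ ≤ ‖s + 1‖ := by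
    rw [← sq_le_sq₀ (norm_nonneg _) (norm_nonneg _), ← Complex.normSq_eq_norm_sq,
      ← Complex.normSq_eq_norm_sq, Complex.normSq_apply, Complex.normSq_apply]
    simp [hsre, hsim]; nlinarith
  have h5 : min (c ^ 2) 1 * (1 + y ^ 2) ≤ ‖s + 1‖ * ‖s‖ := by
    calc min (c ^ 2) 1 * (1 + y ^ 2) ≤ c ^ 2 + y ^ 2 := by
          have e1 := min_le_left (c ^ 2) 1
          have e2 := mul_le_mul_of_nonneg_right (min_le_right (c ^ 2) 1) (sq_nonneg y)
          nlinarith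
      _ = ‖s‖ * ‖s‖ := by rw [← h3]; ring
      _ ≤ ‖s + 1‖ * ‖s‖ := by gcongr
  rw [h1, norm_mul, norm_mul, ← mul_assoc] at h2
  have hpos : 0 < min (c ^ 2) 1 * (1 + y ^ 2) := by positivity
  calc ‖Complex.Gamma s‖ ≤ Real.Gamma (c + 2) / (min (c ^ 2) 1 * (1 + y ^ 2)) := by
        rw [le_div_iff₀ hpos, mul_comm]
        exact (mul_le_mul_of_nonneg_right h5 (norm_nonneg _)).trans h2
    _ = M * (1 + y ^ 2)⁻¹ := by rw [hM]; field_simp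

/-- Mellin inversion for the exponential function. -/
theorem mellinInv_Gamma {c x : ℝ} (hc : 0 < c) (hx : 0 < x) :
    mellinInv c Complex.Gamma x = Real.exp (-x) := by
  have hG : ∀ s : ℂ, 0 < s.re → mellin (fun x : ℝ => (Real.exp (-x) : ℂ)) s = Complex.Gamma s :=
    fun s hs => by rw [Complex.Gamma_eq_integral hs, Complex.GammaIntegral_eq_mellin]
  have hG' : ∀ y : ℝ, mellin (fun x : ℝ => (Real.exp (-x) : ℂ)) (c + y * Complex.I) =
      Complex.Gamma (c + y * Complex.I) := fun y => hG _ (by simpa using hc)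
  have h := mellinInv_mellin_eq c (fun x : ℝ => (Real.exp (-x) : ℂ)) hx ?_ ?_ ?_
  · rw [← h]
    simp only [mellinInv, hG']
  · have := Complex.GammaIntegral_convergent (s := c) (by simpa using hc)
    rw [MellinConvergent]
    refine this.congr (Eventually.of_forall fun t => ?_)
    simp [mul_comm]
  · exact (verticalIntegrable_Gamma hc).congr (Eventually.of_forall fun y => (hG' y).symm)
  · exact Continuous.continuousAt (by fun_prop)

/-! ### The Laplace transform as a Wright function -/

/-- The product form of Mellin-Parseval: one factor is the Mellin transform of `exp (-x)`, the other
that of the density, reflected by `s ↦ 1 - s`. -/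
theorem foxHKernel_genWright (s : ℂ) :
    foxHKernel 1 m (fun j => (1 - ((B j).1 + (B j).2), (B j).2))
      (Fin.cons ((0 : ℝ), (1 : ℝ)) (fun i => (1 - ((A i).1 + (A i).2), (A i).2)) :
        Fin (p + 1) → ℝ × ℝ) s = Complex.Gamma s * foxHKernel m 0 A B (1 - s) := by
  have h0 : (Finset.univ.filter fun j : Fin m => m ≤ j.val) = ∅ := by
    ext j; simp
  have h1 : (Finset.univ.filter fun j : Fin (p + 1) => j.val < 1) = {0} := by
    ext j
    simp only [Finset.mem_filter, Finset.mem_univ, true_and, Finset.mem_singleton, Fin.ext_iff,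
      Fin.val_zero]
    omega
  have h2 : (Finset.univ.filter fun j : Fin (p + 1) => 1 ≤ j.val) =
      Finset.univ.map (Fin.succEmb p) := by
    ext j
    refine Fin.cases ?_ (fun i => ?_) j
    · simp
    · simp
  rw [foxHKernel_lower, foxHKernel, h0, h1, h2]
  simp only [Fin.is_lt, Finset.filter_true, Finset.prod_singleton, Finset.prod_empty, one_mul,
    Finset.prod_map, Fin.coe_succEmb, Fin.cons_succ, Fin.cons_zero]
  rw [mul_div_assoc]
  congr 1
  · simp
  · congr 1 <;>
    · refine Finset.prod_congr rfl fun _ _ => ?_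
      congr 1; push_cast; ring

/-- The Laplace transform of the Fox H-density is a generalized Wright function. -/
theorem HasFoxHDensity.laplace (hAB : FoxHAdmissible A B) (hY : HasFoxHDensity A B Y P) {r : ℝ}
    (hr : 0 ≤ r) : ∫ ω, Real.exp (-r * Y ω) ∂P = 1 / foxHConst A B *
      genWright (fun j => ((B j).1 + (B j).2, (B j).2)) (fun i => ((A i).1 + (A i).2, (A i).2))
        (-r) := by
  have hK := hAB.foxHConst_pos
  have hterm : ∀ k : ℕ, wrightTerm (fun j => ((B j).1 + (B j).2, (B j).2))
      (fun i => ((A i).1 + (A i).2, (A i).2)) (-r) k =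
      foxHConst A B * ∫ ω, (-r * Y ω) ^ k / k.factorial ∂P := fun k => by
    simp_rw [mul_pow, mul_div_right_comm]
    rw [integral_const_mul, (hY.integrable_pow hAB k).2, wrightTerm]
    have h : ∀ a b : ℝ, a * b = foxHConst A B * (b * (a / foxHConst A B)) := fun a b => by
      field_simp
    rw [h]
  rw [genWright]
  split_ifs with hs
  · have h1 : ∀ k : ℕ, Integrable (fun ω => (-r * Y ω) ^ k / k.factorial) P := fun k => by
      simp_rw [mul_pow, mul_div_right_comm]
      exact (hY.integrable_pow hAB k).1.const_mul _
    have h2 := hasSum_integral_of_summable_integral_norm (μ := P) h1 ?_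
    · have h3 : ∀ ω, ∑' k : ℕ, (-r * Y ω) ^ k / k.factorial = Real.exp (-r * Y ω) := fun ω => by
        rw [Real.exp_eq_exp_ℝ, NormedSpace.exp_eq_tsum_div]
      simp_rw [h3] at h2
      simp_rw [hterm]
      rw [tsum_mul_left, h2.tsum_eq]
      field_simp
    · have h4 := hs.norm.mul_left (foxHConst A B)⁻¹
      refine h4.congr fun k => ?_
      -- Because `Y > 0`, each term has the constant sign `(-1) ^ k`. Absolute convergence of the
      -- Wright series is therefore exactly the condition for integrating the exponential series
      -- term by term.
      have h5 : ∀ᵐ ω ∂P, (-r * Y ω) ^ k / k.factorial =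
          (-1) ^ k * ‖(-r * Y ω) ^ k / k.factorial‖ := by
        filter_upwards [hY.ae_pos] with ω hω
        rw [norm_div, norm_pow, norm_mul, norm_neg, Real.norm_of_nonneg hr,
          Real.norm_of_nonneg hω.le, Real.norm_of_nonneg (Nat.cast_nonneg _), neg_mul,
          neg_pow (r * Y ω), ← mul_div_assoc]
      have h6 : 0 ≤ ∫ ω, ‖(-r * Y ω) ^ k / k.factorial‖ ∂P :=
        integral_nonneg fun ω => norm_nonneg _
      rw [hterm, norm_mul, Real.norm_of_nonneg hK.le, ← mul_assoc, inv_mul_cancel₀ hK.ne', one_mul,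
        integral_congr_ae h5, integral_const_mul, norm_mul, Real.norm_of_nonneg h6]
      simp
  -- At `r = 0` only the term `k = 0` survives and the series converges, so this branch has `r > 0`.
  · have hr' : 0 < r := by
      refine hr.lt_of_ne fun h => hs ?_
      refine summable_of_ne_finset_zero (s := {0}) fun k hk => ?_
      rw [Finset.mem_singleton] at hk
      simp [wrightTerm, ← h, hk]
    have hex : ∃ c : ℝ, FoxHSeparates 1 m (fun j => (1 - ((B j).1 + (B j).2), (B j).2))
        (Fin.cons ((0 : ℝ), (1 : ℝ)) (fun i => (1 - ((A i).1 + (A i).2), (A i).2)) :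
          Fin (p + 1) → ℝ × ℝ) c := by
      obtain ⟨ε, hε, hεD⟩ := Metric.isOpen_iff.1 (isOpen_foxHDomain B) 1 hAB.one_mem_foxHDomain
      -- The right-hand separation condition at `c` says that `1 - c` lies in `foxHDomain B`, which
      -- is open and contains `1`.
      refine ⟨ε / 2, fun j hj => ?_, fun j _ => ?_⟩
      · have : j = 0 := by ext; simpa using hj
        subst this
        simp; linarith
      · have := hεD (show 1 - ε / 2 ∈ Metric.ball (1 : ℝ) ε by
          rw [Metric.mem_ball, Real.dist_eq]
          rw [show 1 - ε / 2 - 1 = -(ε / 2) by ring, abs_neg, abs_of_pos (by linarith)]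
          linarith) j
        simp only
        linarith
    simp only [foxH]
    rw [dif_pos hex]
    set c := hex.choose with hc
    have hsep := hex.choose_spec
    rw [← hc] at hsep
    have hc0 : 0 < c := by
      have := hsep.1 0 (by simp)
      simpa using this
    have hcD : 1 - c ∈ foxHDomain B := fun j => by
      have := hsep.2 j j.2
      simp only at this
      linarith
    have hU := hY.complexMGF_log hAB
    have hcD' : -c + 1 ∈ foxHDomain B := by rwa [neg_add_eq_sub]
    have hYm : AEMeasurable (fun ω => Real.log (Y ω)) P :=
      Real.measurable_log.comp_aemeasurable hY.1
    let Φ : Ω → ℝ → ℂ := fun ω y =>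
      Complex.exp (-(c + y * Complex.I) * (Real.log r : ℝ)) *
        (Complex.exp (-(c + y * Complex.I) * (Real.log (Y ω) : ℝ)) *
          Complex.Gamma (c + y * Complex.I))
    -- The modulus splits as `r ^ (-c) * Y ^ (-c) * |Γ(c + iy)|`; the moment of order `-c` is finite
    -- since `1 - c` is an admissible abscissa.
    have hΦ : Integrable (Function.uncurry Φ) (P.prod volume) := by
      have h1 := (hU.1 (-c) hcD').mul_prod (verticalIntegrable_Gamma hc0).norm
      refine (h1.const_mul (Real.exp (-c * Real.log r))).mono' ?_ ?_
      · have hfst : AEMeasurable (fun q : Ω × ℝ => Real.log (Y q.1)) (P.prod volume) :=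
          hYm.comp_quasiMeasurePreserving Measure.quasiMeasurePreserving_fst
        have e1 : AEMeasurable (fun q : Ω × ℝ => Complex.exp (-(c + q.2 * Complex.I) *
            (Real.log (Y q.1) : ℝ))) (P.prod volume) := by fun_prop
        have e2 : AEMeasurable (fun q : Ω × ℝ => Complex.exp (-(c + q.2 * Complex.I) *
            (Real.log r : ℝ))) (P.prod volume) := by fun_prop
        have e3 : AEStronglyMeasurable (fun q : Ω × ℝ => Complex.Gamma (c + q.2 * Complex.I))
            (P.prod volume) := (verticalIntegrable_Gamma hc0).1.comp_snd
        exact e2.aestronglyMeasurable.mul (e1.aestronglyMeasurable.mul e3)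
      · refine Eventually.of_forall fun q => le_of_eq ?_
        simp only [Function.uncurry, Φ, norm_mul, Complex.norm_exp]
        congr 1
        · simp
        · congr 1; simp
    have h1 : ∀ᵐ ω ∂P, (Real.exp (-r * Y ω) : ℂ) = (1 / (2 * Real.pi) : ℝ) • ∫ y, Φ ω y := by
      filter_upwards [hY.ae_pos] with ω hω
      rw [neg_mul, ← mellinInv_Gamma hc0 (mul_pos hr' hω), mellinInv]
      congr 2
      ext y
      simp only [Φ, smul_eq_mul]
      rw [← mul_assoc, ← Complex.exp_add, ← mul_add, ← Complex.ofReal_add,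
        ← Real.log_mul hr'.ne' hω.ne', cexp_mul_log (mul_pos hr' hω)]
    have h2 : ∀ y : ℝ, ∫ ω, Φ ω y ∂P = (r : ℂ) ^ (-(c + y * Complex.I)) •
        (Complex.Gamma (c + y * Complex.I) *
          foxHKernel m 0 A B (1 - (c + y * Complex.I)) / foxHConst A B) := fun y => by
      simp only [Φ]
      have h3 := hU.2 (-(c + y * Complex.I)) (by simpa using hcD')
      rw [complexMGF] at h3
      rw [integral_const_mul, integral_mul_const, h3, cexp_mul_log hr', smul_eq_mul,
        neg_add_eq_sub]
      ring
    have h4 : ((∫ ω, Real.exp (-r * Y ω) ∂P : ℝ) : ℂ) = mellinInv c (foxHKernel 1 m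
        (fun j => (1 - ((B j).1 + (B j).2), (B j).2)) (Fin.cons ((0 : ℝ), (1 : ℝ))
          (fun i => (1 - ((A i).1 + (A i).2), (A i).2)) : Fin (p + 1) → ℝ × ℝ)) r /
        foxHConst A B := by
      rw [← integral_complex_ofReal, integral_congr_ae h1, integral_smul,
        integral_integral_swap hΦ, mellinInv, Complex.real_smul, Complex.real_smul, mul_div_assoc,
        ← integral_div]
      congr 2
      ext y
      rw [h2, foxHKernel_genWright, smul_eq_mul, smul_eq_mul]
      ring
    rw [neg_neg]
    have h5 := congrArg Complex.re h4
    rw [Complex.ofReal_re, Complex.div_ofReal_re] at h5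
    rw [h5]
    ring

end Moments

/-! ### The Mandelbrot-Van Ness kernel -/

/-- The truncated power `(t - x)_+ ^ a`, equal to `0` for `x ≥ t`. -/
noncomputable def truncPow (a t x : ℝ) : ℝ := if x < t then (t - x) ^ a else 0

theorem measurable_truncPow (a t : ℝ) : Measurable (truncPow a t) := by
  refine Measurable.ite measurableSet_Iio ?_ measurable_const
  exact (measurable_const.sub measurable_id).pow_const a

theorem truncPow_translate (a t s x : ℝ) : truncPow a t x = truncPow a (t - s) (x - s) := by
  simp only [truncPow]
  rw [show t - s - (x - s) = t - x by ring]
  simp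

theorem truncPow_scale (a : ℝ) {t : ℝ} (ht : 0 < t) (u x : ℝ) :
    truncPow a (t * u) x = t ^ a * truncPow a u (t⁻¹ * x) := by
  simp only [truncPow]
  have h : t⁻¹ * x < u ↔ x < t * u := by rw [inv_mul_lt_iff₀ ht]
  simp only [h]
  split_ifs with hx
  · rw [← Real.mul_rpow ht.le (by rw [sub_nonneg]; exact (h.2 hx).le)]
    congr 1
    field_simp
  · simp

/-- The squared `L²`-norm of the Mandelbrot-Van Ness kernel at time `1`. -/
noncomputable def mvnConst (H : ℝ) : ℝ :=
  (∫ s in Ioi (0 : ℝ), ((1 + s) ^ (H - 1 / 2) - s ^ (H - 1 / 2)) ^ 2) + 1 / (2 * H)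

theorem mvnConst_pos {H : ℝ} (hH : 0 < H) : 0 < mvnConst H :=
  add_pos_of_nonneg_of_pos (integral_nonneg fun s => sq_nonneg _) (by positivity)

/-- Near `0` the cross term may be dropped, which leaves `2 + s ^ (2a)` with `2a > -1`. At infinity
the mean value theorem gives `a ^ 2 * s ^ (2a - 2)`, with exponent below `-1`. -/
theorem integrableOn_rpow_sub_rpow_sq {a : ℝ} (h1 : -(1 / 2) < a) (h2 : a < 1 / 2) :
    IntegrableOn (fun s : ℝ => ((1 + s) ^ a - s ^ a) ^ 2) (Ioi 0) := by
  have hm : Measurable (fun s : ℝ => ((1 + s) ^ a - s ^ a) ^ 2) := by fun_prop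
  rw [← Ioc_union_Ioi_eq_Ioi (zero_le_one (α := ℝ))]
  refine IntegrableOn.union ?_ ?_
  · have h3 : IntegrableOn (fun s : ℝ => 2 + s ^ (2 * a)) (Ioc 0 1) := by
      have := (intervalIntegral.intervalIntegrable_rpow' (a := 0) (b := 1)
        (r := 2 * a) (by linarith))
      rw [intervalIntegrable_iff_integrableOn_Ioc_of_le zero_le_one] at this
      exact (integrableOn_const (by simp)).add this
    refine Integrable.mono' h3 hm.aestronglyMeasurable ?_
    filter_upwards [ae_restrict_mem measurableSet_Ioc] with s hs
    have hs0 : 0 < s := hs.1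
    rw [Real.norm_of_nonneg (sq_nonneg _)]
    have e1 : s ^ (2 * a) = (s ^ a) ^ 2 := by
      rw [mul_comm, Real.rpow_mul hs0.le]; norm_cast
    have e2 : ((1 + s) ^ a) ^ 2 ≤ 2 := by
      have : ((1 + s) ^ a) ^ 2 = (1 + s) ^ (2 * a) := by
        rw [mul_comm, Real.rpow_mul (by linarith)]; norm_cast
      rw [this]
      calc (1 + s) ^ (2 * a) ≤ (1 + s) ^ (1 : ℝ) :=
            Real.rpow_le_rpow_of_exponent_le (by linarith) (by linarith)
        _ ≤ 2 := by rw [Real.rpow_one]; linarith [hs.2]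
    have e3 : 0 ≤ (1 + s) ^ a * s ^ a := by positivity
    rw [e1]
    nlinarith
  · have h3 : IntegrableOn (fun s : ℝ => a ^ 2 * s ^ (2 * a - 2)) (Ioi 1) :=
      (integrableOn_Ioi_rpow_of_lt (by linarith) zero_lt_one).const_mul _
    refine Integrable.mono' h3 hm.aestronglyMeasurable ?_
    filter_upwards [ae_restrict_mem measurableSet_Ioi] with s hs
    have hs1 : 1 < s := hs
    have hs0 : 0 < s := by linarith
    obtain ⟨ξ, hξ, he⟩ := exists_hasDerivAt_eq_slope (fun x : ℝ => x ^ a)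
      (fun x => a * x ^ (a - 1)) (show s < 1 + s by linarith)
      (fun x hx => (Real.continuousAt_rpow_const x a
        (Or.inl (by linarith [hx.1] : (0 : ℝ) < x).ne')).continuousWithinAt)
      (fun x hx => Real.hasDerivAt_rpow_const (Or.inl (by linarith [hx.1] : (0 : ℝ) < x).ne'))
    have he' : (1 + s) ^ a - s ^ a = a * ξ ^ (a - 1) := by
      rw [he]; simp
    have hξs : ξ ^ (a - 1) ≤ s ^ (a - 1) :=
      Real.rpow_le_rpow_of_nonpos hs0 hξ.1.le (by linarith)
    have e1 : s ^ (2 * a - 2) = (s ^ (a - 1)) ^ 2 := by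
      rw [show 2 * a - 2 = (a - 1) * 2 by ring, Real.rpow_mul hs0.le]; norm_cast
    rw [Real.norm_of_nonneg (sq_nonneg _), he', mul_pow, e1]
    have : 0 ≤ ξ ^ (a - 1) := Real.rpow_nonneg (by linarith [hξ.1]) _
    gcongr

/-- The negative axis contributes the integral in `mvnConst`, after `x ↦ -x`; the interval `[0, 1)`
contributes `1 / (2H)`, and beyond `1` both powers vanish. -/
theorem integrable_truncPow_one_sub_sq {H : ℝ} (hH0 : 0 < H) (hH1 : H < 1) :
    Integrable (fun x => (truncPow (H - 1 / 2) 1 x - truncPow (H - 1 / 2) 0 x) ^ 2) ∧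
    ∫ x, (truncPow (H - 1 / 2) 1 x - truncPow (H - 1 / 2) 0 x) ^ 2 = mvnConst H := by
  set a := H - 1 / 2 with ha
  set d : ℝ → ℝ := fun x => (truncPow a 1 x - truncPow a 0 x) ^ 2 with hd
  have hneg : ∀ x ∈ Iio (0 : ℝ), d x = (fun s : ℝ => ((1 + s) ^ a - s ^ a) ^ 2) (-x) := by
    intro x hx
    have hx0 : x < 0 := hx
    simp only [hd, truncPow, hx0, if_true, show x < 1 by linarith]
    ring_nf
  have hmid : ∀ x ∈ Ico (0 : ℝ) 1, d x = (1 - x) ^ (2 * a) := by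
    intro x hx
    simp only [hd, truncPow, not_lt.2 hx.1, if_false, hx.2, if_true, sub_zero]
    rw [mul_comm 2 a, Real.rpow_mul (by linarith [hx.2])]; norm_cast
  have hbig : ∀ x ∈ Ici (1 : ℝ), d x = 0 := by
    intro x hx
    have hx1 : 1 ≤ x := hx
    simp only [hd, truncPow, not_lt.2 hx1, if_false, not_lt.2 (zero_le_one.trans hx1)]
    simp
  have hI := integrableOn_rpow_sub_rpow_sq (a := a) (by linarith) (by linarith)
  have h1 : IntegrableOn d (Iio 0) := by
    refine IntegrableOn.congr_fun ?_ (fun x hx => (hneg x hx).symm) measurableSet_Iio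
    have := hI.comp_neg
    simpa using this
  have hii : IntervalIntegrable (fun x : ℝ => (1 - x) ^ (2 * a)) volume 0 1 := by
    have := (intervalIntegral.intervalIntegrable_rpow' (a := 0) (b := 1)
        (r := 2 * a) (by linarith)).comp_sub_left 1
    simpa using this.symm
  have h2 : IntegrableOn d (Ico 0 1) := by
    refine IntegrableOn.congr_fun ?_ (fun x hx => (hmid x hx).symm) measurableSet_Ico
    rw [integrableOn_Ico_iff_integrableOn_Ioo, ← integrableOn_Ioc_iff_integrableOn_Ioo]
    rwa [intervalIntegrable_iff_integrableOn_Ioc_of_le zero_le_one] at hii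
  have h3 : IntegrableOn d (Ici 1) :=
    integrableOn_zero.congr_fun (fun x hx => (hbig x hx).symm) measurableSet_Ici
  have e1 : Ico (0 : ℝ) 1 ∪ Ici 1 = Ici 0 := Ico_union_Ici_eq_Ici zero_le_one
  have h4 : IntegrableOn d (Ici 0) := by rw [← e1]; exact h2.union h3
  have h5 : Integrable d := by
    rw [← integrableOn_univ, ← Iio_union_Ici (a := (0 : ℝ))]
    exact h1.union h4
  refine ⟨h5, ?_⟩
  rw [← setIntegral_univ, ← Iio_union_Ici (a := (0 : ℝ)),
    setIntegral_union ((Iio_disjoint_Ici le_rfl)) measurableSet_Ici h1 h4, ← e1,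
    setIntegral_union (s := Ico (0 : ℝ) 1) (t := Ici 1)
      (Set.disjoint_left.2 fun x hx hx' => absurd hx.2 (not_lt.2 hx'))
      measurableSet_Ici h2 h3, setIntegral_congr_fun measurableSet_Iio hneg,
    setIntegral_congr_fun measurableSet_Ico hmid, setIntegral_congr_fun measurableSet_Ici hbig]
  rw [integral_zero, add_zero, mvnConst]
  congr 1
  · rw [← integral_Iic_eq_integral_Iio, integral_comp_neg_Iic 0 (fun s : ℝ => ((1 + s) ^ a - s ^ a) ^ 2),
      neg_zero]
  · rw [integral_Ico_eq_integral_Ioo, ← integral_Ioc_eq_integral_Ioo,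
      ← intervalIntegral.integral_of_le zero_le_one,
      intervalIntegral.integral_comp_sub_left (fun x => x ^ (2 * a)) 1, sub_self, sub_zero,
      integral_rpow (Or.inl (by linarith))]
    rw [show 2 * a + 1 = 2 * H by rw [ha]; ring, Real.one_rpow,
      Real.zero_rpow (by positivity), sub_zero]

/-- Translation by `s` and dilation by `t - s` reduce to the unit interval. In `2H = 2a + 1` the
extra `1` is the Jacobian. -/
theorem integrable_truncPow_sub_sq {H : ℝ} (hH0 : 0 < H) (hH1 : H < 1) (s t : ℝ) :
    Integrable (fun x => (truncPow (H - 1 / 2) t x - truncPow (H - 1 / 2) s x) ^ 2) ∧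
    ∫ x, (truncPow (H - 1 / 2) t x - truncPow (H - 1 / 2) s x) ^ 2 =
      |t - s| ^ (2 * H) * mvnConst H := by
  wlog hst : s ≤ t generalizing s t
  · have := this t s (le_of_not_ge hst)
    rw [abs_sub_comm]
    simp_rw [sub_sq_comm (truncPow (H - 1 / 2) t _)]
    exact this
  set a := H - 1 / 2 with ha
  obtain ⟨hb1, hb2⟩ := integrable_truncPow_one_sub_sq hH0 hH1
  rw [← ha] at hb1 hb2
  rcases hst.eq_or_lt with rfl | hlt
  · simp [Real.zero_rpow (by positivity : 2 * H ≠ 0)]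
  have hr : 0 < t - s := by linarith
  have e : ∀ x, (truncPow a t x - truncPow a s x) ^ 2 = (t - s) ^ (2 * a) *
      (fun x => (truncPow a 1 x - truncPow a 0 x) ^ 2) ((t - s)⁻¹ * (x - s)) := by
    intro x
    rw [truncPow_translate a t s, truncPow_translate a s s, sub_self]
    have h1 := truncPow_scale a hr 1 (x - s)
    have h0 := truncPow_scale a hr 0 (x - s)
    rw [mul_one] at h1
    rw [mul_zero] at h0
    rw [h1, h0, ← mul_sub, mul_pow, mul_comm 2 a, Real.rpow_mul hr.le]
    norm_cast
  simp_rw [e]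
  constructor
  · exact ((hb1.comp_mul_left' (inv_ne_zero hr.ne')).comp_sub_right s).const_mul _
  · rw [integral_const_mul, integral_sub_right_eq_self (fun x =>
      (fun x => (truncPow a 1 x - truncPow a 0 x) ^ 2) ((t - s)⁻¹ * x)),
      Measure.integral_comp_mul_left (fun x => (truncPow a 1 x - truncPow a 0 x) ^ 2), hb2, inv_inv, abs_of_pos hr, smul_eq_mul, ← mul_assoc]
    congr 1
    rw [show 2 * H = 2 * a + 1 by rw [ha]; ring, Real.rpow_add_one hr.ne']

/-! ### Fractional integrals and derivatives of indicators -/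

/-- One formula serves both operators: `b = H - 1/2` for the fractional integral and `b = H + 1/2`
under the derivative. -/
theorem integral_indicator_Ico_mul_rpow {b t : ℝ} (hb : 0 < b) (ht : 0 ≤ t) (x : ℝ) :
    ∫ u in Ioi x, indicator (Ico (0 : ℝ) t) (fun _ => (1 : ℝ)) u * (u - x) ^ (b - 1) =
      (truncPow b t x - truncPow b 0 x) / b := by
  have e1 : ∀ u, indicator (Ico (0 : ℝ) t) (fun _ => (1 : ℝ)) u * (u - x) ^ (b - 1) =
      indicator (Ico (0 : ℝ) t) (fun u => (u - x) ^ (b - 1)) u := by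
    intro u; by_cases hu : u ∈ Ico (0 : ℝ) t <;> simp [hu]
  simp_rw [e1]
  rw [setIntegral_indicator measurableSet_Ico]
  rcases le_or_gt t x with hx | hx
  · have h0 : Ioi x ∩ Ico 0 t = ∅ := by
      ext u; simp only [mem_inter_iff, mem_Ioi, mem_Ico, mem_empty_iff_false, iff_false]
      rintro ⟨h1, _, h2⟩; linarith
    simp [h0, truncPow, not_lt.2 hx, not_lt.2 (ht.trans hx)]
  · have hset : (Ioi x ∩ Ico 0 t : Set ℝ) =ᵐ[volume] Ioc (max x 0) t := by
      have h1 : (Ioi x ∩ Ico 0 t : Set ℝ) =ᵐ[volume] (Ioi x ∩ Ioc 0 t : Set ℝ) :=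
        (ae_eq_refl _).inter (Ico_ae_eq_Ioc)
      refine h1.trans (Eventually.of_forall fun u => propext ?_)
      change u ∈ Ioi x ∩ Ioc 0 t ↔ u ∈ Ioc (max x 0) t
      simp only [mem_inter_iff, mem_Ioi, mem_Ioc, max_lt_iff]
      tauto
    rw [setIntegral_congr_set hset, ← intervalIntegral.integral_of_le (max_le hx.le ht),
      intervalIntegral.integral_comp_sub_right (fun v => v ^ (b - 1)),
      integral_rpow (Or.inl (by linarith)), sub_add_cancel]
    congr 2
    · simp [truncPow, hx]
    · rw [truncPow]
      split_ifs with h0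
      · rw [max_eq_right h0.le]
      · rw [max_eq_left (not_lt.1 h0), sub_self, Real.zero_rpow hb.ne']

theorem hasDerivAt_truncPow {b t x : ℝ} (hx : x ≠ t) :
    HasDerivAt (truncPow b t) (-(b * truncPow (b - 1) t x)) x := by
  rcases hx.lt_or_gt with h | h
  · have h1 : HasDerivAt (fun y : ℝ => (t - y) ^ b) (-(b * (t - x) ^ (b - 1))) x := by
      have : HasDerivAt (fun y : ℝ => (t - y) ^ b) (-1 * b * (t - x) ^ (b - 1)) x :=
        ((hasDerivAt_id x).const_sub t).rpow_const (p := b)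
        (Or.inl (by simp only [id]; linarith : (0 : ℝ) < t - id x).ne')
      convert this using 1
      ring
    rw [truncPow, if_pos h]
    refine h1.congr_of_eventuallyEq ?_
    filter_upwards [Iio_mem_nhds h] with y hy
    exact if_pos hy
  · rw [truncPow, if_neg (not_lt.2 h.le), mul_zero, neg_zero]
    refine (hasDerivAt_const x (0 : ℝ)).congr_of_eventuallyEq ?_
    filter_upwards [Ioi_mem_nhds h] with y hy
    exact if_neg (not_lt.2 (le_of_lt hy))

/-- The factor `Γ(H + 1/2)` of `K_H` cancels the Gamma factor of either operator. Equality is only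
almost everywhere because the derivative is computed away from `0` and `t`. -/
theorem fracOpMinus_indicator_ae {H : ℝ} (hH0 : 0 < H) {t : ℝ} (ht : 0 ≤ t) :
    fracOpMinus H (indicator (Ico (0 : ℝ) t) (fun _ => (1 : ℝ))) =ᵐ[volume]
      fun x => mvnConst H ^ (-(1 / 2) : ℝ) *
        (truncPow (H - 1 / 2) t x - truncPow (H - 1 / 2) 0 x) := by
  have hΓ : Real.Gamma (H + 1 / 2) ≠ 0 := (Real.Gamma_pos_of_pos (by linarith)).ne'
  have hconst : hurstConst H = Real.Gamma (H + 1 / 2) * mvnConst H ^ (-(1 / 2) : ℝ) := rfl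
  rcases lt_trichotomy H (1 / 2) with h | h | h
  · have hne : ∀ᵐ x : ℝ, x ≠ 0 ∧ x ≠ t := by
      have h0 : ∀ᵐ x : ℝ, x ≠ 0 := Measure.ae_ne volume 0
      have h1 : ∀ᵐ x : ℝ, x ≠ t := Measure.ae_ne volume t
      filter_upwards [h0, h1] with x h0 h1 using ⟨h0, h1⟩
    filter_upwards [hne] with x hx
    rw [fracOpMinus, if_pos h, rlDerivMinus, hconst]
    have hb : 0 < H + 1 / 2 := by linarith
    have e : (fun y : ℝ => ∫ u in Ioi y, indicator (Ico (0 : ℝ) t) (fun _ => (1 : ℝ)) u *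
        (u - y) ^ (-(-(H - 1 / 2)))) =
        fun y => (truncPow (H + 1 / 2) t y - truncPow (H + 1 / 2) 0 y) / (H + 1 / 2) := by
      ext y
      rw [← integral_indicator_Ico_mul_rpow hb ht]
      congr 3
      ext u
      congr 2
      ring
    have hd := ((hasDerivAt_truncPow (b := H + 1 / 2) hx.2).sub
      (hasDerivAt_truncPow (b := H + 1 / 2) hx.1)).div_const (H + 1 / 2)
    rw [e, show 1 - -(H - 1 / 2) = H + 1 / 2 by ring]
    have hd' := hd.deriv
    simp only [Pi.sub_def] at hd'
    rw [hd', show H + 1 / 2 - 1 = H - 1 / 2 by ring]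
    field_simp
    ring
  · refine Eventually.of_forall fun x => ?_
    -- At `H = 1/2` the integrand in `mvnConst` vanishes and `1 / (2H) = 1`.
    have hc : mvnConst H ^ (-(1 / 2) : ℝ) = 1 := by
      simp [mvnConst, h]
    rw [fracOpMinus, if_neg (by linarith), if_pos h, hc]
    simp only [one_mul, truncPow, h, sub_self, Real.rpow_zero, indicator, mem_Ico]
    by_cases h0 : x < 0
    · simp [h0, not_le.2 h0, h0.trans_le ht]
    · by_cases h1 : x < t <;> simp [h0, h1, not_lt.1 h0]
  · refine Eventually.of_forall fun x => ?_
    have ha : 0 < H - 1 / 2 := by linarith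
    rw [fracOpMinus, if_neg (by linarith), if_neg h.ne', rlIntegralMinus,
      integral_indicator_Ico_mul_rpow ha ht, hconst,
      show H + 1 / 2 = (H - 1 / 2) + 1 by ring, Real.Gamma_add_one ha.ne']
    have := (Real.Gamma_pos_of_pos ha).ne'
    generalize H - 1 / 2 = a at *
    have := ha.ne'
    field_simp

/-- The integrand `M^H_- 1_{[0,t)}` of the process. -/
noncomputable abbrev fracIndicator (H : ℝ) (t : ℝ≥0) : ℝ → ℝ :=
  fracOpMinus H (indicator (Ico (0 : ℝ) (t : ℝ)) (fun _ => (1 : ℝ)))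

theorem memLp_truncPow_sub {H : ℝ} (hH0 : 0 < H) (hH1 : H < 1) (s t : ℝ) :
    MemLp (fun x => truncPow (H - 1 / 2) t x - truncPow (H - 1 / 2) s x) 2 := by
  refine (memLp_two_iff_integrable_sq
    ((measurable_truncPow _ _).sub (measurable_truncPow _ _)).aestronglyMeasurable).2 ?_
  exact (integrable_truncPow_sub_sq hH0 hH1 s t).1

theorem memLp_fracIndicator {H : ℝ} (hH0 : 0 < H) (hH1 : H < 1) (t : ℝ≥0) :
    MemLp (fracIndicator H t) 2 :=
  (memLp_congr_ae (fracOpMinus_indicator_ae hH0 t.coe_nonneg)).2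
    ((memLp_truncPow_sub hH0 hH1 0 t).const_mul _)

/-- The inner products of the functions `M^H_- 1_{[0,t)}` are the covariances of fractional Brownian
motion. -/
theorem integral_fracIndicator_mul {H : ℝ} (hH0 : 0 < H) (hH1 : H < 1) (s t : ℝ≥0) :
    ∫ x, fracIndicator H s x * fracIndicator H t x =
      1 / 2 * ((s : ℝ) ^ (2 * H) + (t : ℝ) ^ (2 * H) - |(s : ℝ) - (t : ℝ)| ^ (2 * H)) := by
  set a := H - 1 / 2 with ha
  have hJ := mvnConst_pos hH0
  obtain ⟨is, vs⟩ := integrable_truncPow_sub_sq hH0 hH1 0 s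
  obtain ⟨it, vt⟩ := integrable_truncPow_sub_sq hH0 hH1 0 t
  obtain ⟨ist, vst⟩ := integrable_truncPow_sub_sq hH0 hH1 t s
  -- Polarization: `2uv = u² + v² - (u - v)²`, where the difference of two kernels no longer
  -- contains the truncated power at `0`.
  have e : (fun x => fracIndicator H s x * fracIndicator H t x) =ᵐ[volume] fun x =>
      (mvnConst H ^ (-(1 / 2) : ℝ)) ^ 2 * (1 / 2) * ((truncPow a s x - truncPow a 0 x) ^ 2 +
        (truncPow a t x - truncPow a 0 x) ^ 2 - (truncPow a s x - truncPow a t x) ^ 2) := by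
    filter_upwards [fracOpMinus_indicator_ae hH0 s.coe_nonneg,
      fracOpMinus_indicator_ae hH0 t.coe_nonneg] with x h1 h2
    change fracOpMinus H _ x * fracOpMinus H _ x = _
    refine (congrArg₂ (· * ·) h1 h2).trans ?_
    simp only [ha]
    ring
  have hsum := is.add it
  simp only [Pi.add_def] at hsum
  rw [integral_congr_ae e, integral_const_mul, integral_sub hsum ist, integral_add is it, vs, vt,
    vst, sub_zero, sub_zero, abs_of_nonneg s.coe_nonneg, abs_of_nonneg t.coe_nonneg]
  have hc : (mvnConst H ^ (-(1 / 2) : ℝ)) ^ 2 = (mvnConst H)⁻¹ := by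
    rw [← Real.rpow_natCast, ← Real.rpow_mul hJ.le]
    norm_num
    rw [Real.rpow_neg_one]
  rw [hc]
  field_simp

/-! ### Characteristic functions of finite-dimensional distributions -/

theorem aemeasurable_cexp_I {Ω : Type*} [MeasurableSpace Ω] {μ : Measure Ω} {X : Ω → ℝ}
    (hX : AEMeasurable X μ) : AEMeasurable (fun ω => Complex.exp (Complex.I * (X ω : ℝ))) μ := by
  fun_prop

theorem norm_cexp_I (x : ℝ) : ‖Complex.exp (Complex.I * (x : ℝ))‖ = 1 := by
  rw [mul_comm, Complex.norm_exp_ofReal_mul_I]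

theorem integrable_cexp_I {Ω : Type*} [MeasurableSpace Ω] {μ : Measure Ω} [IsFiniteMeasure μ]
    {X : Ω → ℝ} (hX : AEMeasurable X μ) :
    Integrable (fun ω => Complex.exp (Complex.I * (X ω : ℝ))) μ :=
  Integrable.of_bound (aemeasurable_cexp_I hX).aestronglyMeasurable 1
    (Eventually.of_forall fun _ => (norm_cexp_I _).le)

/-- Cramér-Wold: every functional on `Fin n → ℝ` is a combination of coordinates. -/
theorem identDistrib_of_charFun {n : ℕ} {Ω Ω' : Type*} [MeasurableSpace Ω] [MeasurableSpace Ω']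
    {μ : Measure Ω} {P : Measure Ω'} [IsFiniteMeasure μ] [IsFiniteMeasure P]
    {X : Fin n → Ω → ℝ} {Z : Fin n → Ω' → ℝ} (hX : ∀ i, AEMeasurable (X i) μ)
    (hZ : ∀ i, AEMeasurable (Z i) P)
    (h : ∀ c : Fin n → ℝ, ∫ ω, Complex.exp (Complex.I * ((∑ i, c i * X i ω : ℝ) : ℂ)) ∂μ =
      ∫ ω, Complex.exp (Complex.I * ((∑ i, c i * Z i ω : ℝ) : ℂ)) ∂P) :
    IdentDistrib (fun ω i => X i ω) (fun ω i => Z i ω) μ P := by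
  have hX' : AEMeasurable (fun ω i => X i ω) μ := aemeasurable_pi_lambda _ hX
  have hZ' : AEMeasurable (fun ω i => Z i ω) P := aemeasurable_pi_lambda _ hZ
  refine ⟨hX', hZ', Measure.ext_of_charFunDual (funext fun L => ?_)⟩
  have hL : ∀ x : Fin n → ℝ, L x = ∑ i, L (Pi.single i 1) * x i := fun x => by
    conv_lhs => rw [pi_eq_sum_univ' x, map_sum]
    refine Finset.sum_congr rfl fun i _ => ?_
    rw [map_smul, smul_eq_mul, mul_comm]
  have hm : Continuous fun x : Fin n → ℝ => Complex.exp (L x * Complex.I) := by fun_prop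
  rw [charFunDual_apply, charFunDual_apply, integral_map hX' hm.aestronglyMeasurable,
    integral_map hZ' hm.aestronglyMeasurable]
  have := h fun i => L (Pi.single i 1)
  have e : ∀ x, Complex.exp (L x * Complex.I) =
      Complex.exp (Complex.I * ((∑ i, L (Pi.single i 1) * x i : ℝ) : ℂ)) := fun x => by
    rw [← hL x, mul_comm]
  simp_rw [e]
  exact this

/-- The map `x ↦ exp (i * x)` is 1-Lipschitz, and on a probability space the `L¹` norm is at most
the `L²` norm. -/
theorem tendsto_integral_cexp_of_eLpNorm {Ω : Type*} [MeasurableSpace Ω] {μ : Measure Ω}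
    [IsProbabilityMeasure μ] {Z : ℕ → Ω → ℝ} {X : Ω → ℝ} (hZ : ∀ n, AEMeasurable (Z n) μ)
    (hX : AEMeasurable X μ) (h : Tendsto (fun n => eLpNorm (Z n - X) 2 μ) atTop (𝓝 0)) :
    Tendsto (fun n => ∫ ω, Complex.exp (Complex.I * (Z n ω : ℝ)) ∂μ) atTop
      (𝓝 (∫ ω, Complex.exp (Complex.I * (X ω : ℝ)) ∂μ)) := by
  rw [tendsto_iff_edist_tendsto_0]
  refine tendsto_of_tendsto_of_tendsto_of_le_of_le tendsto_const_nhds h (fun n => bot_le)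
    fun n => ?_
  have hsm : AEStronglyMeasurable (Z n - X) μ := ((hZ n).sub hX).aestronglyMeasurable
  rw [edist_eq_enorm_sub, ← integral_sub (integrable_cexp_I (hZ n)) (integrable_cexp_I hX)]
  calc ‖∫ ω, (Complex.exp (Complex.I * (Z n ω : ℝ)) - Complex.exp (Complex.I * (X ω : ℝ))) ∂μ‖ₑ
      ≤ ∫⁻ ω, ‖Complex.exp (Complex.I * (Z n ω : ℝ)) - Complex.exp (Complex.I * (X ω : ℝ))‖ₑ ∂μ :=
        enorm_integral_le_lintegral_enorm _
    _ ≤ ∫⁻ ω, ‖(Z n - X) ω‖ₑ ∂μ := by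
        refine lintegral_mono fun ω => ?_
        have e : Complex.exp (Complex.I * (Z n ω : ℝ)) - Complex.exp (Complex.I * (X ω : ℝ)) =
            Complex.exp (Complex.I * (X ω : ℝ)) *
              (Complex.exp (Complex.I * ((Z n ω - X ω : ℝ) : ℂ)) - 1) := by
          rw [mul_sub, ← Complex.exp_add, mul_one]; congr 2; push_cast; ring
        rw [e, enorm_mul, ← ofReal_norm, norm_cexp_I, ENNReal.ofReal_one, one_mul]
        exact Real.enorm_exp_I_mul_ofReal_sub_one_le
    _ = eLpNorm (Z n - X) 1 μ := (eLpNorm_one_eq_lintegral_enorm).symm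
    _ ≤ eLpNorm (Z n - X) 2 μ := eLpNorm_le_eLpNorm_of_exponent_le (by norm_num) hsm

/-! ### Gaussian mixtures of fractional Brownian motion -/

/-- The covariance function of fractional Brownian motion. -/
noncomputable def fbmCov (H : ℝ) (s t : ℝ≥0) : ℝ :=
  1 / 2 * ((s : ℝ) ^ (2 * H) + (t : ℝ) ^ (2 * H) - |(s : ℝ) - (t : ℝ)| ^ (2 * H))

/-- The variance of `∑ i, c i * B^H_{t i}`. -/
noncomputable def fbmVar (H : ℝ) {n : ℕ} (t : Fin n → ℝ≥0) (c : Fin n → ℝ) : ℝ :=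
  ∑ i, ∑ j, c i * c j * fbmCov H (t i) (t j)

/-- Self-similarity of fractional Brownian motion at the level of covariances. -/
theorem fbmVar_mul (H : ℝ) {n : ℕ} (t : Fin n → ℝ≥0) (c : Fin n → ℝ) (v : ℝ≥0) :
    fbmVar H (fun i => t i * v) c = (v : ℝ) ^ (2 * H) * fbmVar H t c := by
  simp only [fbmVar, Finset.mul_sum]
  refine Finset.sum_congr rfl fun i _ => Finset.sum_congr rfl fun j _ => ?_
  have h : |((t i * v : ℝ≥0) : ℝ) - ((t j * v : ℝ≥0) : ℝ)| = |(t i : ℝ) - t j| * v := by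
    rw [NNReal.coe_mul, NNReal.coe_mul, ← sub_mul, abs_mul, abs_of_nonneg v.coe_nonneg]
  rw [fbmCov, fbmCov, h, NNReal.coe_mul, NNReal.coe_mul,
    Real.mul_rpow (t i).coe_nonneg v.coe_nonneg, Real.mul_rpow (t j).coe_nonneg v.coe_nonneg,
    Real.mul_rpow (abs_nonneg _) v.coe_nonneg]
  ring

section FBM

variable {H : ℝ} {Ω : Type*} [MeasurableSpace Ω] {P : Measure Ω} {BH : ℝ≥0 → Ω → ℝ}

theorem IsFractionalBrownianMotion.map_sum (hBH : IsFractionalBrownianMotion H BH P) {n : ℕ}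
    (t : Fin n → ℝ≥0) (c : Fin n → ℝ) : 0 ≤ fbmVar H t c ∧
    P.map (fun ω => ∑ i, c i * BH (t i) ω) = gaussianReal 0 (fbmVar H t c).toNNReal := by
  have hP := hBH.isGaussianProcess.isProbabilityMeasure
  have hmem : ∀ i, MemLp (fun ω => c i * BH (t i) ω) 2 P := fun i =>
    (hBH.isGaussianProcess.hasGaussianLaw_eval (t i)).memLp_two.const_mul _
  have hG : HasGaussianLaw (fun ω => ∑ i, c i * BH (t i) ω) P := by
    let I : Finset ℝ≥0 := Finset.univ.image t
    let L : (I → ℝ) →L[ℝ] ℝ := ∑ i, c i • ContinuousLinearMap.proj ⟨t i, by simp [I]⟩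
    have := (hBH.isGaussianProcess.hasGaussianLaw I).map_fun L
    simpa [L] using this
  have hvar : Var[fun ω => ∑ i, c i * BH (t i) ω; P] = fbmVar H t c := by
    rw [← covariance_self hG.aemeasurable, covariance_fun_sum_fun_sum hmem hmem]
    refine Finset.sum_congr rfl fun i _ => Finset.sum_congr rfl fun j _ => ?_
    rw [covariance_const_mul_left, covariance_const_mul_right, hBH.covariance_eq, fbmCov]
    ring
  refine ⟨hvar ▸ variance_nonneg _ _, ?_⟩
  rw [hG.map_eq_gaussianReal, hvar, integral_finsetSum _ fun i _ => (hmem i).integrable (by norm_num)]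
  simp [integral_const_mul, hBH.integral_eq_zero]

theorem IsFractionalBrownianMotion.integral_cexp_mul_sum (hBH : IsFractionalBrownianMotion H BH P)
    {n : ℕ} (t : Fin n → ℝ≥0) (c : Fin n → ℝ) (r : ℝ) :
    ∫ ω, Complex.exp (Complex.I * ((r * ∑ i, c i * BH (t i) ω : ℝ) : ℂ)) ∂P =
      Real.exp (-(r ^ 2 * fbmVar H t c / 2)) := by
  obtain ⟨h0, h⟩ := hBH.map_sum t c
  have hm : AEMeasurable (fun ω => ∑ i, c i * BH (t i) ω) P :=
    Finset.aemeasurable_fun_sum _ fun i _ => (hBH.isGaussianProcess.aemeasurable (t i)).const_mul _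
  have h1 := charFun_gaussianReal (μ := 0) (v := (fbmVar H t c).toNNReal) r
  rw [← h, charFun_apply_real, integral_map hm (by fun_prop)] at h1
  have e : ∀ ω, Complex.I * ((r * ∑ i, c i * BH (t i) ω : ℝ) : ℂ) =
      r * ((∑ i, c i * BH (t i) ω : ℝ) : ℂ) * Complex.I := fun ω => by push_cast; ring
  simp_rw [e]
  rw [h1, Complex.ofReal_exp, Real.coe_toNNReal _ h0]
  congr 1
  push_cast
  ring

variable {Y : Ω → ℝ}

theorem measurable_sum_eval {n : ℕ} (t : Fin n → ℝ≥0) (c : Fin n → ℝ) :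
    Measurable fun f : ℝ≥0 → ℝ => ∑ i, c i * f (t i) := by fun_prop

/-- Independence makes the joint law of `Y` and the Gaussian sum a product; Fubini then integrates
the Gaussian variable with `Y` fixed. -/
theorem IsFractionalBrownianMotion.integral_cexp_sqrt_mul_sum
    (hBH : IsFractionalBrownianMotion H BH P) (hYm : AEMeasurable Y P) (hY0 : ∀ᵐ ω ∂P, 0 < Y ω)
    (hindep : IndepFun Y (fun ω t => BH t ω) P) {n : ℕ} (t : Fin n → ℝ≥0) (c : Fin n → ℝ) :
    ∫ ω, Complex.exp (Complex.I * ((∑ i, c i * (Real.sqrt (Y ω) * BH (t i) ω) : ℝ) : ℂ)) ∂P =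
      ((∫ ω, Real.exp (-(fbmVar H t c / 2) * Y ω) ∂P : ℝ) : ℂ) := by
  have hP := hBH.isGaussianProcess.isProbabilityMeasure
  set W : Ω → ℝ := fun ω => ∑ i, c i * BH (t i) ω with hW
  have hWm : AEMeasurable W P :=
    Finset.aemeasurable_fun_sum _ fun i _ => (hBH.isGaussianProcess.aemeasurable (t i)).const_mul _
  have hind : IndepFun Y W P := hindep.comp measurable_id (measurable_sum_eval t c)
  have hmap := (indepFun_iff_map_prod_eq_prod_map_map hYm hWm).1 hind
  let g : ℝ × ℝ → ℂ := fun q => Complex.exp (Complex.I * ((Real.sqrt q.1 * q.2 : ℝ) : ℂ))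
  have hg : Continuous g := by fun_prop
  have e1 : ∀ ω, Complex.exp (Complex.I *
      ((∑ i, c i * (Real.sqrt (Y ω) * BH (t i) ω) : ℝ) : ℂ)) = g (Y ω, W ω) := fun ω => by
    simp only [g, hW, Finset.mul_sum]
    congr 3
    exact Finset.sum_congr rfl fun i _ => by ring
  have := Measure.isProbabilityMeasure_map hYm
  have := Measure.isProbabilityMeasure_map hWm
  simp_rw [e1]
  rw [← integral_map (f := g) (hYm.prodMk hWm) hg.aestronglyMeasurable, hmap, integral_prod _
    (Integrable.of_bound hg.aestronglyMeasurable 1 (Eventually.of_forall fun q =>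
      (norm_cexp_I _).le)), integral_map hYm
    (hg.stronglyMeasurable.integral_prod_right').aestronglyMeasurable, ← integral_complex_ofReal]
  refine integral_congr_ae ?_
  filter_upwards [hY0] with ω hω
  rw [integral_map hWm (by exact (hg.comp (by fun_prop :
    Continuous fun w : ℝ => ((Y ω, w) : ℝ × ℝ))).aestronglyMeasurable)]
  simp only [g]
  rw [hBH.integral_cexp_mul_sum t c, Real.sq_sqrt hω.le]
  congr 2
  ring

/-- No joint measurability of `(t, ω) ↦ BH t ω` is assumed. The random time is approximated by times
with finitely many values, and path continuity passes to the limit. -/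
theorem IsFractionalBrownianMotion.tendsto_comp_simpleFunc
    (hBH : IsFractionalBrownianMotion H BH P) {q : ℝ → ℝ≥0} (s : ℕ → SimpleFunc ℝ ℝ≥0)
    (hs : ∀ y, Tendsto (fun k => s k y) atTop (𝓝 (q y))) (t : ℝ≥0) :
    ∀ᵐ ω ∂P, Tendsto (fun k => BH (t * s k (Y ω)) ω) atTop (𝓝 (BH (t * q (Y ω)) ω)) := by
  filter_upwards [hBH.cont] with ω hω
  exact (hω.tendsto _).comp ((hs (Y ω)).const_mul t)

theorem IsFractionalBrownianMotion.aemeasurable_comp_simpleFunc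
    (hBH : IsFractionalBrownianMotion H BH P) (hYm : AEMeasurable Y P) (s : SimpleFunc ℝ ℝ≥0)
    (t : ℝ≥0) : AEMeasurable (fun ω => BH (t * s (Y ω)) ω) P := by
  have e : (fun ω => BH (t * s (Y ω)) ω) = fun ω => ∑ v ∈ s.range,
      indicator {v} (fun _ => (1 : ℝ)) (s (Y ω)) * BH (t * v) ω := by
    ext ω
    rw [Finset.sum_eq_single (s (Y ω))]
    · simp
    · intro v _ hv; simp [hv.symm]
    · intro h; exact absurd (SimpleFunc.mem_range_self s _) h
  rw [e]
  refine Finset.aemeasurable_fun_sum _ fun v _ => AEMeasurable.mul ?_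
    (hBH.isGaussianProcess.aemeasurable _)
  exact ((measurable_const.indicator (measurableSet_singleton v)).comp
    s.measurable).comp_aemeasurable hYm

theorem IsFractionalBrownianMotion.aemeasurable_comp
    (hBH : IsFractionalBrownianMotion H BH P) (hYm : AEMeasurable Y P) {q : ℝ → ℝ≥0}
    (hq : Measurable q) (t : ℝ≥0) : AEMeasurable (fun ω => BH (t * q (Y ω)) ω) P :=
  aemeasurable_of_tendsto_metrizable_ae atTop
    (fun k => hBH.aemeasurable_comp_simpleFunc hYm (hq.stronglyMeasurable.approx k) t)
    (hBH.tendsto_comp_simpleFunc _ hq.stronglyMeasurable.tendsto_approx t)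

theorem IsFractionalBrownianMotion.integral_cexp_sum_comp_simpleFunc
    (hBH : IsFractionalBrownianMotion H BH P) (hYm : AEMeasurable Y P)
    (hindep : IndepFun Y (fun ω t => BH t ω) P) (s : SimpleFunc ℝ ℝ≥0) {n : ℕ}
    (t : Fin n → ℝ≥0) (c : Fin n → ℝ) :
    ∫ ω, Complex.exp (Complex.I * ((∑ i, c i * BH (t i * s (Y ω)) ω : ℝ) : ℂ)) ∂P =
      ((∫ ω, Real.exp (-((s (Y ω) : ℝ) ^ (2 * H) * fbmVar H t c / 2)) ∂P : ℝ) : ℂ) := by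
  have hP := hBH.isGaussianProcess.isProbabilityMeasure
  let ind : ℝ≥0 → ℝ → ℂ := fun v y => indicator {v} (fun _ => (1 : ℂ)) (s y)
  have hindm : ∀ v, Measurable (ind v) := fun v =>
    (measurable_const.indicator (measurableSet_singleton v)).comp s.measurable
  have hindb : ∀ v y, ‖ind v y‖ ≤ 1 := fun v y => by
    simp only [ind, indicator]; split_ifs <;> simp
  -- Decomposition over the finitely many values `v` of the random time: on each event the time is
  -- deterministic, and the event depends on `Y` only.
  have expand : ∀ (F : ℝ≥0 → Ω → ℂ) ω, F (s (Y ω)) ω = ∑ v ∈ s.range, ind v (Y ω) * F v ω := by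
    intro F ω
    rw [Finset.sum_eq_single (s (Y ω))]
    · simp [ind]
    · intro v _ hv; simp [ind, hv.symm]
    · intro h; exact absurd (SimpleFunc.mem_range_self s _) h
  have hWm : ∀ v : ℝ≥0, AEMeasurable (fun ω => ∑ i, c i * BH (t i * v) ω) P := fun v =>
    Finset.aemeasurable_fun_sum _ fun i _ => (hBH.isGaussianProcess.aemeasurable _).const_mul _
  have hindY : ∀ v, AEStronglyMeasurable (fun ω => ind v (Y ω)) P := fun v =>
    ((hindm v).comp_aemeasurable hYm).aestronglyMeasurable
  rw [← integral_complex_ofReal]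
  have e1 := expand fun v ω => Complex.exp (Complex.I * ((∑ i, c i * BH (t i * v) ω : ℝ) : ℂ))
  have e2 := expand fun v _ => ((Real.exp (-((v : ℝ) ^ (2 * H) * fbmVar H t c / 2)) : ℝ) : ℂ)
  rw [integral_congr_ae (Eventually.of_forall e1), integral_congr_ae (Eventually.of_forall e2),
    integral_finsetSum, integral_finsetSum]
  · refine Finset.sum_congr rfl fun v _ => ?_
    have hind : IndepFun Y (fun ω => ∑ i, c i * BH (t i * v) ω) P :=
      hindep.comp measurable_id (measurable_sum_eval (fun i => t i * v) c)
    have hc : Continuous fun x : ℝ => Complex.exp (Complex.I * (x : ℂ)) := by fun_prop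
    rw [hind.integral_fun_comp_mul_comp (f := ind v)
      (g := fun x : ℝ => Complex.exp (Complex.I * (x : ℂ))) hYm (hWm v)
      (hindm v).aestronglyMeasurable hc.aestronglyMeasurable, integral_mul_const]
    congr 1
    have := hBH.integral_cexp_mul_sum (fun i => t i * v) c 1
    rw [fbmVar_mul] at this
    simpa using this
  · intro v _
    exact (integrable_const _).bdd_mul (hindY v) (Eventually.of_forall fun ω => hindb v (Y ω))
  · intro v _
    exact (integrable_cexp_I (hWm v)).bdd_mul (hindY v)
      (Eventually.of_forall fun ω => hindb v (Y ω))

theorem IsFractionalBrownianMotion.integral_cexp_sum_comp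
    (hBH : IsFractionalBrownianMotion H BH P) (hH : 0 < H) (hYm : AEMeasurable Y P)
    (hindep : IndepFun Y (fun ω t => BH t ω) P) {q : ℝ → ℝ≥0} (hq : Measurable q) {n : ℕ}
    (t : Fin n → ℝ≥0) (c : Fin n → ℝ) :
    ∫ ω, Complex.exp (Complex.I * ((∑ i, c i * BH (t i * q (Y ω)) ω : ℝ) : ℂ)) ∂P =
      ((∫ ω, Real.exp (-((q (Y ω) : ℝ) ^ (2 * H) * fbmVar H t c / 2)) ∂P : ℝ) : ℂ) := by
  have hP := hBH.isGaussianProcess.isProbabilityMeasure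
  let s := hq.stronglyMeasurable.approx
  have hs : ∀ y, Tendsto (fun k => s k y) atTop (𝓝 (q y)) := hq.stronglyMeasurable.tendsto_approx
  have hV := (hBH.map_sum t c).1
  have h1 : Tendsto (fun k => ∫ ω,
      Complex.exp (Complex.I * ((∑ i, c i * BH (t i * s k (Y ω)) ω : ℝ) : ℂ)) ∂P) atTop
      (𝓝 (∫ ω, Complex.exp (Complex.I * ((∑ i, c i * BH (t i * q (Y ω)) ω : ℝ) : ℂ)) ∂P)) := by
    refine tendsto_integral_of_dominated_convergence (fun _ => 1) (fun k => ?_)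
      (integrable_const _) (fun k => Eventually.of_forall fun ω => (norm_cexp_I _).le) ?_
    · exact (aemeasurable_cexp_I (Finset.aemeasurable_fun_sum _ fun i _ =>
        (hBH.aemeasurable_comp_simpleFunc hYm (s k) (t i)).const_mul _)).aestronglyMeasurable
    · have := ae_all_iff.2 fun i => hBH.tendsto_comp_simpleFunc (Y := Y) s hs (t i)
      filter_upwards [this] with ω hω
      have h2 := tendsto_finsetSum (s := Finset.univ) fun i _ => (hω i).const_mul (c i)
      have hc : Continuous fun x : ℝ => Complex.exp (Complex.I * (x : ℂ)) := by fun_prop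
      exact (hc.tendsto _).comp h2
  have h2 : Tendsto (fun k => ∫ ω,
      Real.exp (-((s k (Y ω) : ℝ) ^ (2 * H) * fbmVar H t c / 2)) ∂P) atTop
      (𝓝 (∫ ω, Real.exp (-((q (Y ω) : ℝ) ^ (2 * H) * fbmVar H t c / 2)) ∂P)) := by
    have hc : Continuous fun x : ℝ≥0 => Real.exp (-((x : ℝ) ^ (2 * H) * fbmVar H t c / 2)) := by
      have : Continuous fun x : ℝ≥0 => (x : ℝ) ^ (2 * H) :=
        (Real.continuous_rpow_const (by positivity)).comp NNReal.continuous_coe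
      fun_prop
    refine tendsto_integral_of_dominated_convergence (fun _ => 1) (fun k => ?_)
      (integrable_const _) (fun k => Eventually.of_forall fun ω => ?_) ?_
    · exact ((hc.measurable.comp (s k).measurable).comp_aemeasurable hYm).aestronglyMeasurable
    · rw [Real.norm_of_nonneg (Real.exp_pos _).le, Real.exp_le_one_iff, neg_nonpos]
      positivity
    · exact Eventually.of_forall fun ω => (hc.tendsto _).comp (hs (Y ω))
  refine tendsto_nhds_unique h1 ?_
  simp_rw [hBH.integral_cexp_sum_comp_simpleFunc hYm hindep]
  exact (Complex.continuous_ofReal.tendsto _).comp h2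

end FBM

/-! ### The dual pairing under the generalized Fox-H measure -/

theorem measurable_eval (φ : 𝓢(ℝ, ℝ)) : Measurable fun ω : RealTempered => ω φ := by
  rw [measurable_iff_comap_le]
  exact le_iSup (fun φ : 𝓢(ℝ, ℝ) =>
    MeasurableSpace.comap (fun ω : RealTempered => ω φ) inferInstance) φ

theorem toReal_eLpNorm_two_sq {f : ℝ → ℝ} (hf : MemLp f 2) :
    (eLpNorm f 2 volume).toReal ^ 2 = ∫ x, f x * f x := by
  have h0 : 0 ≤ ∫ x, f x * f x := integral_nonneg fun x => mul_self_nonneg _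
  have e : ∀ x, ‖f x‖ ^ (2 : ℝ) = f x * f x := fun x => by
    rw [Real.rpow_two, Real.norm_eq_abs, sq_abs, sq]
  rw [hf.eLpNorm_eq_integral_rpow_norm (by norm_num) (by norm_num)]
  simp only [ENNReal.toReal_ofNat, e]
  rw [ENNReal.toReal_ofReal (Real.rpow_nonneg h0 _), ← Real.rpow_natCast, ← Real.rpow_mul h0]
  norm_num

theorem tendsto_integral_mul_self {f : ℝ → ℝ} {g : ℕ → ℝ → ℝ} (hf : MemLp f 2)
    (hg : ∀ n, MemLp (g n) 2) (h : Tendsto (fun n => eLpNorm (g n - f) 2 volume) atTop (𝓝 0)) :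
    Tendsto (fun n => ∫ x, g n x * g n x) atTop (𝓝 (∫ x, f x * f x)) := by
  have h1 := ((Lp.tendsto_Lp_iff_tendsto_eLpNorm'' g hg f hf).2 h).norm.pow 2
  simp_rw [Lp.norm_toLp] at h1
  rw [toReal_eLpNorm_two_sq hf] at h1
  exact h1.congr fun n => toReal_eLpNorm_two_sq (hg n)

section Pairing

variable {p m : ℕ} {A : Fin p → ℝ × ℝ} {B : Fin m → ℝ × ℝ} {μ : Measure RealTempered} {H : ℝ}
  {Ω : Type*} [MeasurableSpace Ω] {P : Measure Ω} [IsProbabilityMeasure P] {Y : Ω → ℝ}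
  {BH : ℝ≥0 → Ω → ℝ}

theorem IsFoxHMeasure.integral_cexp_eval (hAB : FoxHAdmissible A B) (hμ : IsFoxHMeasure A B μ)
    (hY : HasFoxHDensity A B Y P) (φ : 𝓢(ℝ, ℝ)) :
    ∫ ω : RealTempered, Complex.exp (Complex.I * ((ω φ : ℝ) : ℂ)) ∂μ =
      ((∫ ω, Real.exp (-((∫ x, φ x * φ x) / 2) * Y ω) ∂P : ℝ) : ℂ) := by
  rw [hμ.charFun_eq, hY.laplace hAB
    (div_nonneg (integral_nonneg fun x => mul_self_nonneg (φ x)) zero_le_two), neg_div]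

theorem fbmVar_one_one (hH : 0 < H) (c : ℝ) :
    fbmVar H (fun _ : Fin 1 => 1) (fun _ => c) = c ^ 2 := by
  simp [fbmVar, fbmCov, Real.zero_rpow (by positivity : 2 * H ≠ 0)]
  ring

/-- The pair `Y`, `BH` serves as a model for a single evaluation: `BH 1` is standard Gaussian, so
second moments under `μ` can be read off from `√Y * BH 1`. -/
theorem IsFoxHMeasure.identDistrib_eval (hAB : FoxHAdmissible A B) (hH : 0 < H)
    (hμ : IsFoxHMeasure A B μ) (hY : HasFoxHDensity A B Y P)
    (hBH : IsFractionalBrownianMotion H BH P) (hindep : IndepFun Y (fun ω t => BH t ω) P)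
    (φ : 𝓢(ℝ, ℝ)) : IdentDistrib (fun ω : RealTempered => ω φ)
      (fun ω => (eLpNorm φ 2 volume).toReal * (Real.sqrt (Y ω) * BH 1 ω)) μ P := by
  have := hμ.isProbabilityMeasure
  have hZ : AEMeasurable (fun ω => (eLpNorm φ 2 volume).toReal * (Real.sqrt (Y ω) * BH 1 ω)) P :=
    ((Real.continuous_sqrt.measurable.comp_aemeasurable hY.1).mul
      (hBH.isGaussianProcess.aemeasurable 1)).const_mul _
  have h := identDistrib_of_charFun (n := 1) (μ := μ) (P := P) (X := fun _ ω => ω φ)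
    (Z := fun _ ω => (eLpNorm φ 2 volume).toReal * (Real.sqrt (Y ω) * BH 1 ω))
    (fun _ => (measurable_eval φ).aemeasurable) (fun _ => hZ) fun c => ?_
  · exact h.comp (measurable_pi_apply 0)
  · have h1 := hμ.integral_cexp_eval hAB hY (c 0 • φ)
    have h2 := hBH.integral_cexp_sqrt_mul_sum hY.1 hY.ae_pos hindep (fun _ : Fin 1 => 1)
      (fun _ => c 0 * (eLpNorm φ 2 volume).toReal)
    have e1 : ∀ ω : RealTempered, ∑ i, c i * ω φ = ω (c 0 • φ) := fun ω => by simp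
    have e2 : ∀ ω, ∑ i, c i * ((eLpNorm φ 2 volume).toReal * (Real.sqrt (Y ω) * BH 1 ω)) =
        ∑ _i : Fin 1, c 0 * (eLpNorm φ 2 volume).toReal * (Real.sqrt (Y ω) * BH 1 ω) := fun ω => by
      simp [mul_assoc]
    have e3 : ∫ x, (c 0 • φ) x * (c 0 • φ) x = c 0 ^ 2 * ∫ x, φ x * φ x := by
      rw [← integral_const_mul]
      refine integral_congr_ae (Eventually.of_forall fun x => ?_)
      simp only [smul_apply, smul_eq_mul]
      ring
    simp_rw [e1, e2]
    rw [h1, h2, fbmVar_one_one hH, mul_pow, toReal_eLpNorm_two_sq (φ.memLp 2 volume)]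
    rw [e3]

theorem memLp_sqrt_mul_fbm (hAB : FoxHAdmissible A B) (hY : HasFoxHDensity A B Y P)
    (hBH : IsFractionalBrownianMotion H BH P) (hindep : IndepFun Y (fun ω t => BH t ω) P) :
    MemLp (fun ω => Real.sqrt (Y ω) * BH 1 ω) 2 P := by
  have hm : AEMeasurable (fun ω => Real.sqrt (Y ω) * BH 1 ω) P :=
    (Real.continuous_sqrt.measurable.comp_aemeasurable hY.1).mul
      (hBH.isGaussianProcess.aemeasurable 1)
  refine (memLp_two_iff_integrable_sq hm.aestronglyMeasurable).2 ?_
  have h1 : Integrable Y P := by simpa using (hY.integrable_pow hAB 1).1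
  have h2 : Integrable (fun ω => BH 1 ω ^ 2) P :=
    (hBH.isGaussianProcess.hasGaussianLaw_eval 1).memLp_two.integrable_sq
  have hind : IndepFun Y (fun ω => BH 1 ω ^ 2) P :=
    hindep.comp measurable_id ((measurable_pi_apply 1).pow_const 2)
  refine (hind.integrable_mul h1 h2).congr ?_
  filter_upwards [hY.ae_pos] with ω hω
  simp [mul_pow, Real.sq_sqrt hω.le]

theorem IsFoxHMeasure.memLp_eval (hAB : FoxHAdmissible A B) (hH : 0 < H)
    (hμ : IsFoxHMeasure A B μ) (hY : HasFoxHDensity A B Y P)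
    (hBH : IsFractionalBrownianMotion H BH P) (hindep : IndepFun Y (fun ω t => BH t ω) P)
    (φ : 𝓢(ℝ, ℝ)) : MemLp (fun ω : RealTempered => ω φ) 2 μ :=
  (hμ.identDistrib_eval hAB hH hY hBH hindep φ).symm.memLp_snd
    ((memLp_sqrt_mul_fbm hAB hY hBH hindep).const_mul _)

/-- Up to a finite constant, `φ ↦ ⟨·, φ⟩` is an isometry from `L²(ℝ)` to `L²(μ)`; this is what
allows the extension to all of `L²(ℝ)`. -/
theorem IsFoxHMeasure.eLpNorm_eval (hAB : FoxHAdmissible A B) (hH : 0 < H)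
    (hμ : IsFoxHMeasure A B μ) (hY : HasFoxHDensity A B Y P)
    (hBH : IsFractionalBrownianMotion H BH P) (hindep : IndepFun Y (fun ω t => BH t ω) P)
    (φ : 𝓢(ℝ, ℝ)) : eLpNorm (fun ω : RealTempered => ω φ) 2 μ =
      eLpNorm φ 2 volume * eLpNorm (fun ω => Real.sqrt (Y ω) * BH 1 ω) 2 P := by
  rw [(hμ.identDistrib_eval hAB hH hY hBH hindep φ).eLpNorm_eq]
  have := eLpNorm_const_smul (eLpNorm φ 2 volume).toReal
    (fun ω => Real.sqrt (Y ω) * BH 1 ω) 2 P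
  refine Eq.trans this ?_
  rw [← ofReal_norm, Real.norm_of_nonneg ENNReal.toReal_nonneg,
    ENNReal.ofReal_toReal (φ.memLp 2 volume).2.ne]

/-- Schwartz functions are dense in `L²`, and the scaled isometry carries Cauchy sequences to Cauchy
sequences. Existence guarantees that `dualPairing` is not its default value `0`. -/
theorem IsFoxHMeasure.exists_isDualPairing (hAB : FoxHAdmissible A B) (hH : 0 < H)
    (hμ : IsFoxHMeasure A B μ) (hY : HasFoxHDensity A B Y P)
    (hBH : IsFractionalBrownianMotion H BH P) (hindep : IndepFun Y (fun ω t => BH t ω) P)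
    {f : ℝ → ℝ} (hf : MemLp f 2) : ∃ X : RealTempered → ℝ, IsDualPairing μ f X := by
  have hdense := SchwartzMap.denseRange_toLpCLM (E := ℝ) (F := ℝ) (p := 2) (μ := volume)
    ENNReal.ofNat_ne_top
  obtain ⟨u, hu, hlim⟩ := mem_closure_iff_seq_limit.1 (hdense (hf.toLp f))
  choose φ hφ using hu
  have hL := hμ.memLp_eval hAB hH hY hBH hindep
  have hφ' : ∀ n, u n = ((φ n).memLp 2).toLp (φ n) := fun n => (hφ n).symm
  have hlim1 : Tendsto (fun n => ((φ n).memLp 2 volume).toLp (φ n)) atTop (𝓝 (hf.toLp f)) := by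
    rwa [funext hφ'] at hlim
  have hlim2 := (Lp.tendsto_Lp_iff_tendsto_eLpNorm'' (fun n => ⇑(φ n))
    (fun n => (φ n).memLp 2 volume) f hf).1 hlim1
  set C := eLpNorm (fun ω => Real.sqrt (Y ω) * BH 1 ω) 2 P with hC
  have hCtop : C ≠ ∞ := (memLp_sqrt_mul_fbm hAB hY hBH hindep).2.ne
  have hcauchy : CauchySeq fun n => (hL (φ n)).toLp := by
    have h1 := cauchySeq_iff_tendsto_dist_atTop_0.1 hlim1.cauchySeq
    refine cauchySeq_iff_tendsto_dist_atTop_0.2 ?_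
    have h2 := h1.mul_const C.toReal
    rw [zero_mul] at h2
    refine h2.congr fun q => ?_
    rw [dist_eq_norm, dist_eq_norm, ← MemLp.toLp_sub, ← MemLp.toLp_sub, Lp.norm_toLp, Lp.norm_toLp,
      ← ENNReal.toReal_mul]
    have e := hμ.eLpNorm_eval hAB hH hY hBH hindep (φ q.1 - φ q.2)
    have e1 : (fun ω : RealTempered => ω (φ q.1 - φ q.2)) =
        (fun ω : RealTempered => ω (φ q.1)) - fun ω => ω (φ q.2) := by
      ext ω; simp
    have e2 : ⇑(φ q.1 - φ q.2) = ⇑(φ q.1) - ⇑(φ q.2) := by ext x; simp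
    rw [e1, e2] at e
    rw [e]
  obtain ⟨X, hX⟩ := cauchySeq_tendsto_of_complete hcauchy
  refine ⟨X, Lp.memLp X, φ, hlim2, ?_⟩
  have h3 : Tendsto (fun n => (hL (φ n)).toLp) atTop (𝓝 ((Lp.memLp X).toLp X)) := by
    rwa [Lp.toLp_coeFn]
  exact (Lp.tendsto_Lp_iff_tendsto_eLpNorm'' (fun n (ω : RealTempered) => ω (φ n))
    (fun n => hL (φ n)) X (Lp.memLp X)).1 h3

theorem isDualPairing_dualPairing {f : ℝ → ℝ} (h : ∃ X : RealTempered → ℝ, IsDualPairing μ f X) :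
    IsDualPairing μ f (dualPairing μ f) := by
  rw [dualPairing, dif_pos h]
  exact h.choose_spec

theorem tendsto_eLpNorm_sum {α : Type*} [MeasurableSpace α] {ν : Measure α} {n : ℕ}
    (c : Fin n → ℝ) {g : Fin n → ℕ → α → ℝ} {f : Fin n → α → ℝ}
    (hg : ∀ i k, MemLp (g i k) 2 ν) (hf : ∀ i, MemLp (f i) 2 ν)
    (h : ∀ i, Tendsto (fun k => eLpNorm (fun x => g i k x - f i x) 2 ν) atTop (𝓝 0)) :
    Tendsto (fun k => eLpNorm ((fun x => ∑ i, c i * g i k x) - fun x => ∑ i, c i * f i x) 2 ν)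
      atTop (𝓝 0) := by
  have h1 : Tendsto (fun k => ∑ i, ‖c i‖ₑ * eLpNorm (fun x => g i k x - f i x) 2 ν) atTop
      (𝓝 (∑ _i : Fin n, 0)) := by
    refine tendsto_finsetSum _ fun i _ => ?_
    have := ENNReal.Tendsto.const_mul (h i) (Or.inr (enorm_ne_top : ‖c i‖ₑ ≠ ∞))
    rwa [mul_zero] at this
  rw [Finset.sum_const_zero] at h1
  refine tendsto_of_tendsto_of_tendsto_of_le_of_le tendsto_const_nhds h1 (fun k => bot_le)
    fun k => ?_
  have e : ((fun x => ∑ i, c i * g i k x) - fun x => ∑ i, c i * f i x) =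
      ∑ i, c i • fun x => g i k x - f i x := by
    ext x
    simp [mul_sub, Finset.sum_sub_distrib]
  rw [e]
  refine (eLpNorm_sum_le (fun i _ => (((hg i k).sub (hf i)).const_smul (c i)).1) (by norm_num)).trans
    (Finset.sum_le_sum fun i _ => ?_)
  rw [eLpNorm_const_smul]
  rfl

theorem integral_mul_self_sum_fracIndicator (hH0 : 0 < H) (hH1 : H < 1) {n : ℕ} (t : Fin n → ℝ≥0)
    (c : Fin n → ℝ) : ∫ x, (∑ i, c i * fracIndicator H (t i) x) *
      (∑ i, c i * fracIndicator H (t i) x) = fbmVar H t c := by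
  have hint : ∀ i j, Integrable fun x =>
      c i * fracIndicator H (t i) x * (c j * fracIndicator H (t j) x) := fun i j =>
    ((memLp_fracIndicator hH0 hH1 (t i)).const_mul (c i)).integrable_mul
      ((memLp_fracIndicator hH0 hH1 (t j)).const_mul (c j))
  simp_rw [Finset.sum_mul_sum]
  rw [integral_finsetSum _ fun i _ => integrable_finsetSum _ fun j _ => hint i j]
  refine Finset.sum_congr rfl fun i _ => ?_
  rw [integral_finsetSum _ fun j _ => hint i j]
  refine Finset.sum_congr rfl fun j _ => ?_
  rw [fbmCov, ← integral_fracIndicator_mul hH0 hH1, ← integral_const_mul]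
  refine integral_congr_ae (Eventually.of_forall fun x => ?_)
  simp only
  ring

theorem IsFoxHMeasure.isDualPairing_foxHProcess (hAB : FoxHAdmissible A B) (hH0 : 0 < H)
    (hH1 : H < 1) (hμ : IsFoxHMeasure A B μ) (hY : HasFoxHDensity A B Y P)
    (hBH : IsFractionalBrownianMotion H BH P) (hindep : IndepFun Y (fun ω t => BH t ω) P)
    (t : ℝ≥0) : IsDualPairing μ (fracIndicator H t) (foxHProcess H μ t) :=
  isDualPairing_dualPairing
    (hμ.exists_isDualPairing hAB hH0 hY hBH hindep (memLp_fracIndicator hH0 hH1 t))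

/-- The characteristic functions of the finite-dimensional distributions of the Fox-H process. -/
theorem IsFoxHMeasure.integral_cexp_sum_foxHProcess (hAB : FoxHAdmissible A B) (hH0 : 0 < H)
    (hH1 : H < 1) (hμ : IsFoxHMeasure A B μ) (hY : HasFoxHDensity A B Y P)
    (hBH : IsFractionalBrownianMotion H BH P) (hindep : IndepFun Y (fun ω t => BH t ω) P)
    {n : ℕ} (t : Fin n → ℝ≥0) (c : Fin n → ℝ) :
    ∫ ω, Complex.exp (Complex.I * ((∑ i, c i * foxHProcess H μ (t i) ω : ℝ) : ℂ)) ∂μ =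
      ((∫ ω, Real.exp (-(fbmVar H t c / 2) * Y ω) ∂P : ℝ) : ℂ) := by
  have := hμ.isProbabilityMeasure
  have hpair := hμ.isDualPairing_foxHProcess hAB hH0 hH1 hY hBH hindep
  choose φ hφ1 hφ2 using fun i => (hpair (t i)).2
  have hXm := fun i => (hpair (t i)).1
  have hL := hμ.memLp_eval hAB hH0 hY hBH hindep
  have hf := fun i => memLp_fracIndicator hH0 hH1 (t i)
  -- The same combinations of Schwartz functions approximate the combined integrand in `L²(ℝ)` and
  -- the combined pairing in `L²(μ)`, so the limit of the characteristic functional is computed in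
  -- two ways.
  let ψ : ℕ → 𝓢(ℝ, ℝ) := fun k => ∑ i, c i • φ i k
  have hψ : ∀ k x, ψ k x = ∑ i, c i * φ i k x := fun k x => by
    simp [ψ]
  have hψω : ∀ k (ω : RealTempered), ω (ψ k) = ∑ i, c i * ω (φ i k) := fun k ω => by
    simp [ψ]
  have h1 := tendsto_eLpNorm_sum c (fun i k => hL (φ i k)) hXm hφ2
  have h2 := tendsto_eLpNorm_sum c (fun i k => (φ i k).memLp 2 volume) hf hφ1
  have h3 := tendsto_integral_cexp_of_eLpNorm (μ := μ)
    (fun k => Finset.aemeasurable_fun_sum _ fun i _ =>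
      ((measurable_eval (φ i k)).const_mul (c i)).aemeasurable)
    (Finset.aemeasurable_fun_sum _ fun i _ => (hXm i).1.aemeasurable.const_mul (c i)) h1
  have h4 := tendsto_integral_mul_self (memLp_finsetSum _ fun i _ => (hf i).const_mul (c i))
    (fun k => memLp_finsetSum _ fun i _ => ((φ i k).memLp 2 volume).const_mul (c i)) h2
  rw [integral_mul_self_sum_fracIndicator hH0 hH1] at h4
  have h5 : Tendsto (fun k => ∫ ω, Real.exp (-((∫ x, ψ k x * ψ k x) / 2) * Y ω) ∂P) atTop
      (𝓝 (∫ ω, Real.exp (-(fbmVar H t c / 2) * Y ω) ∂P)) := by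
    simp_rw [hψ]
    refine tendsto_integral_of_dominated_convergence (fun _ => 1) (fun k => ?_)
      (integrable_const _) (fun k => ?_) ?_
    · exact (Real.measurable_exp.comp_aemeasurable (hY.1.const_mul _)).aestronglyMeasurable
    · filter_upwards [hY.ae_pos] with ω hω
      rw [Real.norm_of_nonneg (Real.exp_pos _).le, Real.exp_le_one_iff, neg_mul, neg_nonpos]
      exact mul_nonneg (div_nonneg (integral_nonneg fun x => mul_self_nonneg _) zero_le_two) hω.le
    · exact Eventually.of_forall fun ω =>
        (Real.continuous_exp.tendsto _).comp ((h4.div_const 2).neg.mul_const (Y ω))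
  refine tendsto_nhds_unique h3 ?_
  refine ((Complex.continuous_ofReal.tendsto _).comp h5).congr fun k => ?_
  simp only [Function.comp]
  rw [← hμ.integral_cexp_eval hAB hY (ψ k)]
  simp_rw [hψω]

end Pairing

theorem mainTheorem2 {p m : ℕ} (A : Fin p → ℝ × ℝ) (B : Fin m → ℝ × ℝ)
    (hAB : FoxHAdmissible A B)
    (H : ℝ) (hH0 : 0 < H) (hH1 : H < 1)
    (μ : Measure RealTempered) (hμ : IsFoxHMeasure A B μ)
    {Ω : Type*} [MeasurableSpace Ω] (P : Measure Ω) [IsProbabilityMeasure P]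
    (Y : Ω → ℝ) (hY : HasFoxHDensity A B Y P)
    (BH : ℝ≥0 → Ω → ℝ) (hBH : IsFractionalBrownianMotion H BH P)
    (hindep : IndepFun Y (fun ω t => BH t ω) P) :
    EqualFDD (foxHProcess H μ) μ (fun t ω => Real.sqrt (Y ω) * BH t ω) P ∧
    EqualFDD (fun t ω => Real.sqrt (Y ω) * BH t ω) P
      (fun t ω => BH (t * (Y ω).toNNReal ^ (1 / (2 * H))) ω) P := by
  have := hμ.isProbabilityMeasure
  have hZ : ∀ t, AEMeasurable (fun ω => Real.sqrt (Y ω) * BH t ω) P := fun t =>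
    (Real.continuous_sqrt.measurable.comp_aemeasurable hY.1).mul
      (hBH.isGaussianProcess.aemeasurable t)
  have hq : Measurable fun y : ℝ => y.toNNReal ^ (1 / (2 * H)) :=
    measurable_real_toNNReal.pow_const _
  constructor
  · intro n t
    refine identDistrib_of_charFun (X := fun i => foxHProcess H μ (t i))
      (Z := fun i ω => Real.sqrt (Y ω) * BH (t i) ω) (fun i => ?_) (fun i => hZ (t i)) fun c => ?_
    · exact (hμ.isDualPairing_foxHProcess hAB hH0 hH1 hY hBH hindep (t i)).1.1.aemeasurable
    · rw [hμ.integral_cexp_sum_foxHProcess hAB hH0 hH1 hY hBH hindep,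
        hBH.integral_cexp_sqrt_mul_sum hY.1 hY.ae_pos hindep]
  · intro n t
    refine identDistrib_of_charFun (X := fun i ω => Real.sqrt (Y ω) * BH (t i) ω)
      (Z := fun i ω => BH (t i * (Y ω).toNNReal ^ (1 / (2 * H))) ω) (fun i => hZ (t i))
      (fun i => hBH.aemeasurable_comp hY.1 hq (t i)) fun c => ?_
    rw [hBH.integral_cexp_sqrt_mul_sum hY.1 hY.ae_pos hindep,
      hBH.integral_cexp_sum_comp hH0 hY.1 hindep hq]
    congr 1
    refine integral_congr_ae ?_
    filter_upwards [hY.ae_pos] with ω hω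
    -- `(Y ^ (1 / (2H))) ^ (2H) = Y`; the truncation `toNNReal` has no effect because `Y > 0` almost
    -- surely.
    rw [NNReal.coe_rpow, Real.coe_toNNReal _ hω.le, ← Real.rpow_mul hω.le,
      one_div_mul_cancel (by positivity), Real.rpow_one]
    congr 1
    ring
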